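/- **Ultragraphs.** An ultragraph $\mathcal G=(G^0,\mathcal G^1,r,s)$ consists of countable sets $G^0$ (vertices) and $\mathcal G^1$ (edges), a map $s:\mathcal G^1\to G^0$ and a map $r$ from $\mathcal G^1$ to the non-empty subsets of $G^0$. Let $\mathcal G^0$ be the algebra of subsets of $G^0$ generated by all $\{v\}$ and $r(e)$, i.e. the smallest collection which contains these sets and $\emptyset$ and is closed under $\cup,\cap,\setminus$. Let $R$ be a commutative ring with unit; $R$-algebras are associative but need not be unital, and ideals are two-sided. The Leavitt path algebra $L_R(\mathcal G)$ is the universal $R$-algebra generated by elements $p_A$ ($A\in\mathcal G^0$), $s_e,s_{e^*}$ ($e\in\mathcal G^1$) subject to 1. $p_\emptyset=0$, $p_Ap_B=p_{A\cap B}$, $p_{A\cup B}=p_A+p_B-p_{A\cap B}$; 2. $p_{s(e)}s_e=s_ep_{r(e)}=s_e$ and $p_{r(e)}s_{e^*}=s_{e^*}p_{s(e)}=s_{e^*}$, where $p_v:=p_{\{v\}}$; 3. $s_{e^*}s_f=\delta_{e,f}\,p_{r(e)}$; 4. $p_v=\sum_{s(e)=v}s_es_{e^*}$ whenever $0<|s^{-1}(v)|<\infty$.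 A path is a finite sequence $\alpha=\alpha_1\cdots\alpha_n$ of edges with $s(\alpha_{i+1})\in r(\alpha_i)$; $|\alpha|=n\ge 0$ is its length, $s_\alpha=s_{\alpha_1}\cdots s_{\alpha_n}$ and $s_{\alpha^*}=s_{\alpha_n^*}\cdots s_{\alpha_1^*}$ (these factors are omitted if $n=0$). Put $L_R(\mathcal G)_n=\mathrm{span}_R\{s_\alpha p_As_{\beta^*}: \alpha,\beta \text{ paths},\ A\in\mathcal G^0,\ |\alpha|-|\beta|=n\}$ for $n\in\mathbb Z$. An ideal $I$ of $L_R(\mathcal G)$ is graded if $I=\sum_{n}(I\cap L_R(\mathcal G)_n)$. **Admissible pairs.** A collection $H\subseteq\mathcal G^0$ with $\emptyset\in H$ is hereditary if (i) $\{s(e)\}\in H$ implies $r(e)\in H$, (ii) $A,B\in H$ implies $A\cup B\in H$, (iii) $A\in H$, $B\in\mathcal G^0$, $B\subseteq A$ imply $B\in H$. It is saturated if for every $v$ with $0<|s^{-1}(v)|<\infty$ such that $r(e)\in H$ for all $e$ with $s(e)=v$, one has $\{v\}\in H$. Let $$B_H=\{v\in G^0: |s^{-1}(v)|=\infty,\ 0<|\{e:s(e)=v,\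 r(e)\notin H\}|<\infty\}.$$ An admissible pair is a pair $(H,S)$ with $H$ hereditary and saturated and $S\subseteq B_H$. For $w\in B_H$ put $p_w^H=p_w-\sum_{s(e)=w,\,r(e)\notin H}s_es_{e^*}$, and let $I_{(H,S)}$ be the ideal of $L_R(\mathcal G)$ generated by $\{p_A:A\in H\}\cup\{p_w^H:w\in S\}$. For an ideal $I$ of $L_R(\mathcal G)$ put $H_I=\{A\in\mathcal G^0:p_A\in I\}$. The ideal $I$ is basic if for all $c\in R\setminus\{0\}$: $cp_A\in I$ implies $p_A\in I$ for $A\in\mathcal G^0$, and $cp_w^{H_I}\in I$ implies $p_w^{H_I}\in I$ for $w\in B_{H_I}$. **Quotient ultragraphs.** Let $(H,S)$ be an admissible pair. Put $\overline G^0=G^0\sqcup\{w':w\in B_H\setminus S\}$ and $\overline A=A\cup\{w':w\in A\cap(B_H\setminus S)\}$ for $A\subseteq G^0$. Let $\overline{\mathcal G}$ be the ultragraph with vertex set $\overline G^0$, edge set $\mathcal G^1$, $\overline r(e)=\overline{r(e)}$, and $\overline s(e)=s(e)'$ if $s(e)\in B_H\setminus S$ and $r(e)\in H$, $\overline s(e)=s(e)$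 otherwise; let $\overline{\mathcal G}^0$ be its algebra of sets. For $A,B\in\overline{\mathcal G}^0$ write $A\sim B$ if $A\cup V=B\cup V$ for some $V\in H$. Let $[A]$ be the class of $A$; $\cup,\cap,\setminus$ are defined on classes through representatives, and $[v]:=[\{v\}]$. The quotient ultragraph $\mathcal G/(H,S)$ has the vertices $[v]$ ($v\in G^0$, $\{v\}\notin H$) and $[w']$ ($w\in B_H\setminus S$), the edges $e\in\mathcal G^1$ with $r(e)\notin H$, the source map $e\mapsto[\overline s(e)]$ and the range map $e\mapsto[\overline r(e)]$. Its algebra $(\mathcal G/(H,S))^0$ is the smallest collection of classes which contains $[\emptyset]$, its vertices and the ranges of its edges and is closed under $\cup,\cap,\setminus$. Its Leavitt path algebra $L_R(\mathcal G/(H,S))$ is the universal $R$-algebra generated by elements $q_{[A]}$ ($[A]\in(\mathcal G/(H,S))^0$), $t_e,t_{e^*}$ ($e$ an edge of $\mathcal G/(H,S)$) subject to the relations 1–4 above, read in $\mathcal G/(H,S)$ (in 4, $[v]$ runs through the vertices of $\mathcal G/(H,S)$ that are the source of at least one and only finitely many edges of $\mathcal G/(H,S)$). **Theorem.** Let $\mathcal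 G$ be an ultragraph and $R$ a commutative ring with unit. 1. For every admissible pair $(H,S)$ in $\mathcal G$, $L_R(\mathcal G/(H,S))\cong L_R(\mathcal G)/I_{(H,S)}$ as $R$-algebras. 2. If $R\neq 0$, then $(H,S)\mapsto I_{(H,S)}$ is a bijection from the set of all admissible pairs in $\mathcal G$ onto the set of all graded basic ideals of $L_R(\mathcal G)$. -/

import Mathlib

/-!
Ultragraphs, quotient ultragraphs, and their Leavitt path algebras.

All algebras here are associative but not necessarily unital, and ideals are two-sided.
-/

noncomputable section

/-! ### Presented algebras -/

section Quotient

variable {A : Type*} [NonUnitalRing A]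

/-- A two-sided ideal which is stable under the action of the scalars `R`. -/
class SMulClosed (R : Type*) [SMul R A] (I : TwoSidedIdeal A) : Prop where
  smul_mem : ∀ (c : R) {x : A}, x ∈ I → c • x ∈ I

/-- The quotient `A / I` as a (non-unital) ring. -/
def IdealQuotient (I : TwoSidedIdeal A) : Type _ := I.ringCon.Quotient

namespace IdealQuotient

instance (I : TwoSidedIdeal A) : NonUnitalRing (IdealQuotient I) :=
  inferInstanceAs (NonUnitalRing I.ringCon.Quotient)

/-- The quotient map `A → A / I`. -/
def mk (I : TwoSidedIdeal A) : A →ₙ+* IdealQuotient I where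
  toFun x := (x : I.ringCon.Quotient)
  map_zero' := rfl
  map_add' _ _ := rfl
  map_mul' _ _ := rfl

theorem mk_surjective (I : TwoSidedIdeal A) : Function.Surjective (mk I) :=
  fun x => Quotient.inductionOn' x fun a => ⟨a, rfl⟩

theorem mk_eq_mk (I : TwoSidedIdeal A) {x y : A} : mk I x = mk I y ↔ x - y ∈ I := by
  rw [← I.rel_iff]
  exact I.ringCon.eq

variable {R : Type*} [CommRing R] [Module R A]

instance (I : TwoSidedIdeal A) [SMulClosed R I] : SMul R (IdealQuotient I) where
  smul c := Quotient.map' (c • ·) fun x y h => by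
    have h' : x - y ∈ I := (I.rel_iff x y).1 h
    refine (I.rel_iff _ _).2 ?_
    rw [← smul_sub]
    exact SMulClosed.smul_mem c h'

theorem mk_smul (I : TwoSidedIdeal A) [SMulClosed R I] (c : R) (x : A) :
    mk I (c • x) = c • mk I x := rfl

instance (I : TwoSidedIdeal A) [SMulClosed R I] : Module R (IdealQuotient I) :=
  Function.Surjective.module R (mk I : A →+ IdealQuotient I) (mk_surjective I) (mk_smul I)

instance (I : TwoSidedIdeal A) [SMulClosed R I] [IsScalarTower R A A] :
    IsScalarTower R (IdealQuotient I) (IdealQuotient I) where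
  smul_assoc c x y := by
    obtain ⟨x, rfl⟩ := mk_surjective I x
    obtain ⟨y, rfl⟩ := mk_surjective I y
    simp only [smul_eq_mul, ← mk_smul, ← map_mul, smul_mul_assoc]

instance (I : TwoSidedIdeal A) [SMulClosed R I] [SMulCommClass R A A] :
    SMulCommClass R (IdealQuotient I) (IdealQuotient I) where
  smul_comm c x y := by
    obtain ⟨x, rfl⟩ := mk_surjective I x
    obtain ⟨y, rfl⟩ := mk_surjective I y
    simp only [smul_eq_mul, ← mk_smul, ← map_mul, mul_smul_comm]

end IdealQuotient

/-- The ideal of the `R`-algebra `A` generated by the elements `x - y` for all pairs with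
`rel x y`. -/
def relIdeal (R : Type*) [SMul R A] (rel : A → A → Prop) : TwoSidedIdeal A :=
  sInf {I | SMulClosed R I ∧ ∀ x y, rel x y → x - y ∈ I}

instance (R : Type*) [SMul R A] (rel : A → A → Prop) : SMulClosed R (relIdeal R rel) where
  smul_mem c x hx := by
    rw [relIdeal, TwoSidedIdeal.mem_sInf] at hx ⊢
    exact fun I hI => hI.1.smul_mem c (hx I hI)

theorem sub_mem_relIdeal (R : Type*) [SMul R A] {rel : A → A → Prop} {x y : A} (h : rel x y) :
    x - y ∈ relIdeal R rel := by
  rw [relIdeal, TwoSidedIdeal.mem_sInf]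
  exact fun I hI => hI.2 x y h

end Quotient

/-! ### Leavitt path algebras -/

/-- The data which (quotient) ultragraphs have in common: edges whose sources are vertices and
whose ranges are elements of some collection `B`, of which the vertices are elements too.
For an ultragraph, `B` consists of sets of vertices, and a vertex `v` is regarded as `{v}`. -/
structure UltragraphData (B E : Type*) where
  vert : Set B
  s : E → B
  r : E → B
  s_mem : ∀ e, s e ∈ vert

namespace UltragraphData

variable {B E : Type*} [EmptyCollection B] [Union B] [Inter B] [SDiff B]

/-- The smallest subcollection of `B` which contains `C` and `∅` and is closed under `∪`, `∩`
and `\`. -/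
inductive AlgebraGen (C : Set B) : B → Prop
  | basic {A : B} (h : A ∈ C) : AlgebraGen C A
  | empty : AlgebraGen C ∅
  | union {A A' : B} (h : AlgebraGen C A) (h' : AlgebraGen C A') : AlgebraGen C (A ∪ A')
  | inter {A A' : B} (h : AlgebraGen C A) (h' : AlgebraGen C A') : AlgebraGen C (A ∩ A')
  | sdiff {A A' : B} (h : AlgebraGen C A) (h' : AlgebraGen C A') : AlgebraGen C (A \ A')

variable (D : UltragraphData B E)

/-- The algebra generated by the vertices and the ranges of edges. -/
def alg : Set B := {A | AlgebraGen (D.vert ∪ Set.range D.r) A}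

theorem vert_mem_alg {v : B} (hv : v ∈ D.vert) : v ∈ D.alg := .basic (Or.inl hv)

theorem s_mem_alg (e : E) : D.s e ∈ D.alg := D.vert_mem_alg (D.s_mem e)

theorem r_mem_alg (e : E) : D.r e ∈ D.alg := .basic (Or.inr ⟨e, rfl⟩)

/-- The alphabet: a letter for every element of the algebra, every edge and every ghost edge. -/
inductive Letter
  | set (A : D.alg) : Letter
  | edge (e : E) : Letter
  | ghost (e : E) : Letter

variable (R : Type*) [CommRing R]

/-- The free (non-unital) `R`-algebra on the alphabet, spanned by the non-empty words. -/
abbrev Free : Type _ := MonoidAlgebra R (FreeSemigroup D.Letter)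

namespace Free

/-- A letter as an element of the free algebra. -/
def letter (x : D.Letter) : D.Free R := MonoidAlgebra.single (FreeSemigroup.of x) 1

/-- The generator belonging to an element of the algebra. -/
abbrev p (A : B) (hA : A ∈ D.alg) : D.Free R := letter D R (.set ⟨A, hA⟩)

/-- The generator belonging to an edge. -/
abbrev t (e : E) : D.Free R := letter D R (.edge e)

/-- The generator belonging to a ghost edge. -/
abbrev tStar (e : E) : D.Free R := letter D R (.ghost e)

end Free

open Free

/-- The defining relations (LP1) - (LP4) of a Leavitt family. -/
inductive Rel : D.Free R → D.Free R → Prop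
  | empty : Rel (p D R ∅ .empty) 0
  | inter (A A' : B) (h : A ∈ D.alg) (h' : A' ∈ D.alg) :
      Rel (p D R A h * p D R A' h') (p D R (A ∩ A') (.inter h h'))
  | union (A A' : B) (h : A ∈ D.alg) (h' : A' ∈ D.alg) :
      Rel (p D R (A ∪ A') (.union h h'))
        (p D R A h + p D R A' h' - p D R (A ∩ A') (.inter h h'))
  | source_edge (e : E) : Rel (p D R (D.s e) (D.s_mem_alg e) * t D R e) (t D R e)
  | edge_range (e : E) : Rel (t D R e * p D R (D.r e) (D.r_mem_alg e)) (t D R e)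
  | range_ghost (e : E) : Rel (p D R (D.r e) (D.r_mem_alg e) * tStar D R e) (tStar D R e)
  | ghost_source (e : E) : Rel (tStar D R e * p D R (D.s e) (D.s_mem_alg e)) (tStar D R e)
  | ghost_edge (e : E) : Rel (tStar D R e * t D R e) (p D R (D.r e) (D.r_mem_alg e))
  | ghost_edge_ne (e f : E) (h : e ≠ f) : Rel (tStar D R e * t D R f) 0
  | vertex (v : B) (hv : v ∈ D.vert) (hne : {e | D.s e = v}.Nonempty)
      (hfin : {e | D.s e = v}.Finite) :
      Rel (p D R v (D.vert_mem_alg hv)) (∑ e ∈ hfin.toFinset, t D R e * tStar D R e)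

/-- The Leavitt path algebra: the free algebra modulo the ideal generated by the relations
of a Leavitt family. -/
def LeavittAlgebra : Type _ := IdealQuotient (relIdeal R (Rel D R))

namespace LeavittAlgebra

instance : NonUnitalRing (D.LeavittAlgebra R) :=
  inferInstanceAs (NonUnitalRing (IdealQuotient (relIdeal R (Rel D R))))

instance : Module R (D.LeavittAlgebra R) :=
  inferInstanceAs (Module R (IdealQuotient (relIdeal R (Rel D R))))

instance : IsScalarTower R (D.LeavittAlgebra R) (D.LeavittAlgebra R) :=
  inferInstanceAs (IsScalarTower R (IdealQuotient (relIdeal R (Rel D R)))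
    (IdealQuotient (relIdeal R (Rel D R))))

instance : SMulCommClass R (D.LeavittAlgebra R) (D.LeavittAlgebra R) :=
  inferInstanceAs (SMulCommClass R (IdealQuotient (relIdeal R (Rel D R)))
    (IdealQuotient (relIdeal R (Rel D R))))

/-- The quotient map from the free algebra. -/
def proj : D.Free R →ₙₐ[R] D.LeavittAlgebra R where
  __ := IdealQuotient.mk (relIdeal R (Rel D R))
  map_smul' := IdealQuotient.mk_smul (relIdeal R (Rel D R))

theorem proj_surjective : Function.Surjective (proj D R) :=
  IdealQuotient.mk_surjective (relIdeal R (Rel D R))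

variable {D R} in
theorem proj_eq {x y : D.Free R} (h : Rel D R x y) : proj D R x = proj D R y :=
  (IdealQuotient.mk_eq_mk (relIdeal R (Rel D R))).2 (sub_mem_relIdeal R h)

/-- The element `p_A`. -/
def p (A : D.alg) : D.LeavittAlgebra R := proj D R (Free.p D R A.1 A.2)

/-- The element `s_e`. -/
def t (e : E) : D.LeavittAlgebra R := proj D R (Free.t D R e)

/-- The element `s_{e^*}`. -/
def tStar (e : E) : D.LeavittAlgebra R := proj D R (Free.tStar D R e)

end LeavittAlgebra

end UltragraphData

/-! ### Ultragraphs -/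

/-- An ultragraph with vertex set `V` and edge set `E`. -/
structure Ultragraph (V E : Type*) where
  s : E → V
  r : E → Set V
  r_nonempty : ∀ e, (r e).Nonempty

namespace Ultragraph

open UltragraphData

variable {V E : Type*} (G : Ultragraph V E)

/-- The underlying data of an ultragraph, in which a vertex `v` is regarded as `{v}`. -/
def toData : UltragraphData (Set V) E where
  vert := Set.range fun v => {v}
  s e := {G.s e}
  r := G.r
  s_mem e := ⟨G.s e, rfl⟩

/-- The algebra `𝒢⁰` in the power set of `V` generated by all `{v}` and all `r e`. -/
def sets : Set (Set V) := G.toData.alg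

theorem singleton_mem_sets (v : V) : {v} ∈ G.sets := G.toData.vert_mem_alg ⟨v, rfl⟩

section LeavittPathAlgebra

variable (R : Type*) [CommRing R]

/-- The Leavitt path algebra `L_R(𝒢)`. -/
abbrev LeavittPathAlgebra : Type _ := G.toData.LeavittAlgebra R

/-- The idempotent `p_A` in `L_R(𝒢)`, for `A` in `𝒢⁰`. -/
def p (A : G.sets) : G.LeavittPathAlgebra R := LeavittAlgebra.p G.toData R A

/-- The element `s_e` in `L_R(𝒢)`. -/
def t (e : E) : G.LeavittPathAlgebra R := LeavittAlgebra.t G.toData R e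

/-- The element `s_{e^*}` in `L_R(𝒢)`. -/
def tStar (e : E) : G.LeavittPathAlgebra R := LeavittAlgebra.tStar G.toData R e

variable {R} in
/-- Every element has a left unit of the form `p_A`. -/
theorem exists_left_unit (x : G.LeavittPathAlgebra R) : ∃ A, G.p R A * x = x := by
  obtain ⟨x, rfl⟩ := LeavittAlgebra.proj_surjective G.toData R x
  have key : ∀ A A' : G.sets, A.1 ⊆ A'.1 → G.p R A' * G.p R A = G.p R A := by
    intro A A' h
    have := LeavittAlgebra.proj_eq (Rel.inter (D := G.toData) (R := R) A'.1 A.1 A'.2 A.2)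
    rw [map_mul] at this
    refine this.trans ?_
    simp only [Set.inter_eq_self_of_subset_right h]
    rfl
  have mono : ∀ (A A' : G.sets) (y : G.LeavittPathAlgebra R), A.1 ⊆ A'.1 →
      G.p R A * y = y → G.p R A' * y = y := by
    intro A A' y h hy
    rw [← hy, ← mul_assoc, key A A' h]
  have hgen : ∀ l : G.toData.Letter, ∃ A, G.p R A *
      LeavittAlgebra.proj G.toData R (Free.letter G.toData R l) =
      LeavittAlgebra.proj G.toData R (Free.letter G.toData R l) := by
    rintro (A | e | e)
    · exact ⟨A, key A A subset_rfl⟩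
    · refine ⟨⟨_, G.toData.s_mem_alg e⟩, ?_⟩
      have := LeavittAlgebra.proj_eq (Rel.source_edge (D := G.toData) (R := R) e)
      rwa [map_mul] at this
    · refine ⟨⟨_, G.toData.r_mem_alg e⟩, ?_⟩
      have := LeavittAlgebra.proj_eq (Rel.range_ghost (D := G.toData) (R := R) e)
      rwa [map_mul] at this
  induction x using MonoidAlgebra.induction_linear with
  | zero => exact ⟨⟨∅, .empty⟩, by simp⟩
  | add f g hf hg =>
    obtain ⟨A, hA⟩ := hf
    obtain ⟨A', hA'⟩ := hg
    refine ⟨⟨A.1 ∪ A'.1, .union A.2 A'.2⟩, ?_⟩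
    rw [map_add, mul_add, mono A _ _ Set.subset_union_left hA,
      mono A' _ _ Set.subset_union_right hA']
  | single w c =>
    induction w using FreeSemigroup.recOnMul with
    | ih1 l =>
      obtain ⟨A, hA⟩ := hgen l
      have h : (MonoidAlgebra.single (FreeSemigroup.of l) c : G.toData.Free R) =
          c • Free.letter G.toData R l := by
        simp [Free.letter]
      exact ⟨A, by rw [h, map_smul, mul_smul_comm, hA]⟩
    | ih2 l w _ _ =>
      obtain ⟨A, hA⟩ := hgen l
      have h : (MonoidAlgebra.single (FreeSemigroup.of l * w) c : G.toData.Free R) =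
          Free.letter G.toData R l * MonoidAlgebra.single w c := by
        simp [Free.letter, MonoidAlgebra.single_mul_single]
      exact ⟨A, by rw [h, map_mul, ← mul_assoc, hA]⟩

/-- Because of the local units, every two-sided ideal of the ring `L_R(𝒢)` is an ideal of the
`R`-algebra `L_R(𝒢)`. -/
instance (I : TwoSidedIdeal (G.LeavittPathAlgebra R)) : SMulClosed R I where
  smul_mem c x hx := by
    obtain ⟨A, hA⟩ := G.exists_left_unit x
    rw [← hA, ← smul_mul_assoc]
    exact I.mul_mem_left _ _ hx

/-- A list of edges is a path if the source of each edge lies in the range of the previous one.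
The empty list stands for the paths of length zero. -/
def IsPath (α : List E) : Prop := α.IsChain fun e f => G.s f ∈ G.r e

/-- The element `s_α p_A s_{β^*}`. -/
def monomial (α : List E) (A : G.sets) (β : List E) : G.LeavittPathAlgebra R :=
  α.foldr (fun e x => G.t R e * x) (β.foldr (fun e x => x * G.tStar R e) (G.p R A))

/-- The homogeneous component of degree `n`, spanned by all `s_α p_A s_{β^*}` with
`|α| - |β| = n`. -/
def homogeneous (n : ℤ) : Submodule R (G.LeavittPathAlgebra R) :=
  Submodule.span R {x | ∃ (α β : List E) (A : G.sets), G.IsPath α ∧ G.IsPath β ∧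
    (α.length : ℤ) - β.length = n ∧ x = G.monomial R α A β}

variable {R} in
/-- An ideal `I` is graded if it is the sum of the `I ∩ L_R(𝒢)_n`. -/
def IsGraded (I : TwoSidedIdeal (G.LeavittPathAlgebra R)) : Prop :=
  ∀ x ∈ I, ∃ f : ℤ →₀ G.LeavittPathAlgebra R,
    (∀ n, f n ∈ I ∧ f n ∈ G.homogeneous R n) ∧ x = f.sum fun _ y => y

end LeavittPathAlgebra

/-! ### Admissible pairs -/

/-- Hereditary subcollections of `𝒢⁰` (always containing the empty set). -/
structure IsHereditary (H : Set (Set V)) : Prop where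
  subset_sets : H ⊆ G.sets
  empty_mem : ∅ ∈ H
  range_mem : ∀ e, {G.s e} ∈ H → G.r e ∈ H
  union_mem : ∀ A ∈ H, ∀ A' ∈ H, A ∪ A' ∈ H
  mem_of_subset : ∀ A ∈ H, ∀ A' ∈ G.sets, A' ⊆ A → A' ∈ H

/-- Saturated subcollections. -/
def IsSaturated (H : Set (Set V)) : Prop :=
  ∀ v, {e | G.s e = v}.Nonempty → {e | G.s e = v}.Finite →
    (∀ e, G.s e = v → G.r e ∈ H) → {v} ∈ H

/-- The set `B_H` of breaking vertices. -/
def breaking (H : Set (Set V)) : Set V :=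
  {v | {e | G.s e = v}.Infinite ∧ {e | G.s e = v ∧ G.r e ∉ H}.Nonempty ∧
    {e | G.s e = v ∧ G.r e ∉ H}.Finite}

/-- Admissible pairs `(H, S)`. -/
@[ext]
structure AdmissiblePair where
  H : Set (Set V)
  S : Set V
  hereditary : G.IsHereditary H
  saturated : G.IsSaturated H
  subset_breaking : S ⊆ G.breaking H

section Ideals

variable (R : Type*) [CommRing R]

/-- The gap idempotent `p_w^H` of a breaking vertex `w`. -/
def gap (H : Set (Set V)) (w : G.breaking H) : G.LeavittPathAlgebra R :=
  G.p R ⟨{w.1}, G.singleton_mem_sets w.1⟩ -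
    ∑ e ∈ w.2.2.2.toFinset, G.t R e * G.tStar R e

/-- The ideal `I_{(H,S)}`. -/
def idealOf (P : G.AdmissiblePair) : TwoSidedIdeal (G.LeavittPathAlgebra R) :=
  TwoSidedIdeal.span ({x | ∃ A : G.sets, A.1 ∈ P.H ∧ x = G.p R A} ∪
    {x | ∃ w : G.breaking P.H, w.1 ∈ P.S ∧ x = G.gap R P.H w})

variable {R}

/-- The collection `H_I` of all `A` in `𝒢⁰` with `p_A ∈ I`. -/
def collectionOf (I : TwoSidedIdeal (G.LeavittPathAlgebra R)) : Set (Set V) :=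
  {A | ∃ h : A ∈ G.sets, G.p R ⟨A, h⟩ ∈ I}

/-- Basic ideals. -/
def IsBasic (I : TwoSidedIdeal (G.LeavittPathAlgebra R)) : Prop :=
  (∀ (A : G.sets) (c : R), c ≠ 0 → c • G.p R A ∈ I → G.p R A ∈ I) ∧
  (∀ (w : G.breaking (G.collectionOf I)) (c : R), c ≠ 0 →
    c • G.gap R (G.collectionOf I) w ∈ I → G.gap R (G.collectionOf I) w ∈ I)

end Ideals

/-! ### Quotient ultragraphs -/

namespace AdmissiblePair

variable {G} (P : G.AdmissiblePair)

/-- The vertices of `𝒢̄`: those of `𝒢` together with a copy `w'` of each `w ∈ B_H \ S`. -/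
abbrev BarVertex : Type _ := V ⊕ ↥(G.breaking P.H \ P.S)

/-- `Ā = A ∪ {w' : w ∈ A ∩ (B_H \ S)}`. -/
def barSet (A : Set V) : Set P.BarVertex := {x | Sum.elim id Subtype.val x ∈ A}

open Classical in
/-- The ultragraph `𝒢̄`. -/
def bar : Ultragraph P.BarVertex E where
  s e := if h : G.s e ∈ G.breaking P.H \ P.S ∧ G.r e ∈ P.H then .inr ⟨G.s e, h.1⟩
    else .inl (G.s e)
  r e := P.barSet (G.r e)
  r_nonempty e := (G.r_nonempty e).imp' Sum.inl fun _ h => h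

/-- `A ∼ B` if and only if `A ∪ W = B ∪ W` for some `W ∈ H`. -/
def setoid : Setoid P.bar.sets where
  r A A' := ∃ W ∈ P.H, A.1 ∪ Sum.inl '' W = A'.1 ∪ Sum.inl '' W
  iseqv :=
    { refl := fun _ => ⟨∅, P.hereditary.empty_mem, rfl⟩
      symm := fun ⟨W, hW, h⟩ => ⟨W, hW, h.symm⟩
      trans := fun {A A' A''} ⟨W, hW, h⟩ ⟨W', hW', h'⟩ =>
        ⟨W ∪ W', P.hereditary.union_mem W hW W' hW', by
          rw [Set.image_union, ← Set.union_assoc, h, Set.union_right_comm, h',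
            Set.union_right_comm, Set.union_assoc]⟩ }

/-- The collection of the classes `[A]` for `A` in the algebra `𝒢̄⁰`. -/
def Class : Type _ := Quotient P.setoid

/-- The class `[A]`. -/
def cls (A : Set P.BarVertex) (hA : A ∈ P.bar.sets) : P.Class := Quotient.mk P.setoid ⟨A, hA⟩

instance : EmptyCollection P.Class := ⟨P.cls ∅ .empty⟩

/-- The equivalence relation is compatible with the Boolean set operations. -/
theorem rel_op {f : Prop → Prop → Prop} {A A' B B' C C' : Set P.BarVertex}
    (hC : ∀ x, x ∈ C ↔ f (x ∈ A) (x ∈ B)) (hC' : ∀ x, x ∈ C' ↔ f (x ∈ A') (x ∈ B'))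
    (h : ∃ W ∈ P.H, A ∪ Sum.inl '' W = A' ∪ Sum.inl '' W)
    (h' : ∃ W ∈ P.H, B ∪ Sum.inl '' W = B' ∪ Sum.inl '' W) :
    ∃ W ∈ P.H, C ∪ Sum.inl '' W = C' ∪ Sum.inl '' W := by
  obtain ⟨W, hW, h⟩ := h
  obtain ⟨W', hW', h'⟩ := h'
  refine ⟨W ∪ W', P.hereditary.union_mem W hW W' hW', ?_⟩
  ext x
  have h1 := Set.ext_iff.1 h x
  have h2 := Set.ext_iff.1 h' x
  simp only [Set.image_union, Set.mem_union, hC, hC'] at h1 h2 ⊢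
  by_cases hx : x ∈ Sum.inl '' W
  · simp [hx]
  by_cases hx' : x ∈ Sum.inl '' W'
  · simp [hx']
  simp only [hx, hx', or_false] at h1 h2 ⊢
  rw [h1, h2]

/-- `[A] ∪ [B] = [A ∪ B]`. -/
instance : Union P.Class where
  union := Quotient.map₂ (fun A B => ⟨A.1 ∪ B.1, .union A.2 B.2⟩) fun _ _ h _ _ h' =>
    P.rel_op (f := Or) (fun _ => Iff.rfl) (fun _ => Iff.rfl) h h'

/-- `[A] ∩ [B] = [A ∩ B]`. -/
instance : Inter P.Class where
  inter := Quotient.map₂ (fun A B => ⟨A.1 ∩ B.1, .inter A.2 B.2⟩) fun _ _ h _ _ h' =>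
    P.rel_op (f := And) (fun _ => Iff.rfl) (fun _ => Iff.rfl) h h'

/-- `[A] \ [B] = [A \ B]`. -/
instance : SDiff P.Class where
  sdiff := Quotient.map₂ (fun A B => ⟨A.1 \ B.1, .sdiff A.2 B.2⟩) fun _ _ h _ _ h' =>
    P.rel_op (f := fun a b => a ∧ ¬ b) (fun _ => Iff.rfl) (fun _ => Iff.rfl) h h'

/-- The class `[v]` of a vertex of `𝒢̄`. -/
def vertexClass (v : P.BarVertex) : P.Class := P.cls {v} (P.bar.singleton_mem_sets v)

/-- The quotient ultragraph `𝒢/(H,S)`. -/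
def quotient : UltragraphData P.Class {e : E // G.r e ∉ P.H} where
  vert := {x | ∃ v : V, {v} ∉ P.H ∧ x = P.vertexClass (.inl v)} ∪
    {x | ∃ w : ↥(G.breaking P.H \ P.S), x = P.vertexClass (.inr w)}
  s e := P.vertexClass (P.bar.s e.1)
  r e := P.cls (P.bar.r e.1) (P.bar.toData.r_mem_alg e.1)
  s_mem e := Or.inl ⟨G.s e.1, fun h => e.2 (P.hereditary.range_mem e.1 h), by
    simp [bar, e.2]⟩

end AdmissiblePair

end Ultragraph

end

/-!
The argument compares `L_R(𝒢)` with the algebra of the quotient ultragraph through two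
homomorphisms, `toQuotient : L_R(𝒢) → L_R(𝒢/(H,S))` and
`ofQuotient : L_R(𝒢/(H,S)) → L_R(𝒢)/I_{(H,S)}`, both obtained from the universal property
(`LeavittFamily.lift`). The first sends `p_A` to `q_[Ā]` and kills the edges with range in `H`;
it is surjective and kills `I_{(H,S)}`. For the second, a set `B` in the algebra of `𝒢̄` contains
only one of `w` and `w'` for only finitely many `w ∈ B_H \ S`, so that `p_{B ∩ G⁰}` can be corrected
by a finite sum of gap idempotents `± p_w^H` (`barRep`); modulo the ideal this depends on the class
`[B]` only. Since the composite is the quotient map, `ofQuotient` is an isomorphism and the kernel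
of `toQuotient` is exactly `I_{(H,S)}`.

The bijection rests on two facts about `L_R(𝒢/(H,S))`. They are proved for every `UltragraphData`
whose collection is faithfully modelled by subsets of a set `X`, with vertices as atoms and
non-empty ranges (`SetModel`). For quotient ultragraphs such a model is given by Stone duality, the
points being the ultrafilters which avoid `H`; plain vertices do not suffice, because a non-empty
class need not contain any vertex of the quotient.

* `SetModel.smul_p_eq_zero`: if `c • p_A = 0`, then `c = 0` or `A = ∅`. The algebra is represented
  on functions on `X × List (E ⊕ X)`. Thanks to the second factor, the Schröder-Bernstein theorem
  provides bijections between a vertex and the disjoint union of the ranges of its edges.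
  Consequently `I_{(H,S)}` is basic and determines `(H, S)`. It is graded because its generators
  are homogeneous.
* `SetModel.eq_zero_of_mem_degreePart` (graded uniqueness): an ideal without non-zero multiples of
  the idempotents `p_A`, `A ≠ ∅`, contains no non-zero homogeneous element. One removes ghost edges
  by multiplying with edges from the right. An element `x` annihilated by all edges is annihilated
  by the sources of its last ghost edges (by relation (LP4) at a finite emitter, by an edge not
  occurring in `x` at an infinite emitter); off these sources it contains no ghost edges, where the
  statement reduces to linear combinations of idempotents.

If `I` is a graded basic ideal and `(H, S)` the pair which it determines, then `I_{(H,S)} ⊆ I`, and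
the image of `I` under `toQuotient` contains no non-zero multiples of idempotents
(`smul_p_mem_mapIdeal`); so graded uniqueness yields that every homogeneous element of `I` lies in
`I_{(H,S)}`.
-/

noncomputable section

/-! ### The universal property of Leavitt path algebras -/

namespace UltragraphData

variable {B E : Type*} [EmptyCollection B] [Union B] [Inter B] [SDiff B]
  {D : UltragraphData B E} {R : Type*} [CommRing R]

namespace LeavittAlgebra

theorem p_empty : p D R ⟨∅, .empty⟩ = 0 :=
  (proj_eq Rel.empty).trans (map_zero _)

theorem p_mul_p (A A' : D.alg) :
    p D R A * p D R A' = p D R ⟨A.1 ∩ A'.1, .inter A.2 A'.2⟩ :=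
  (map_mul _ _ _).symm.trans (proj_eq (Rel.inter A.1 A'.1 A.2 A'.2))

theorem p_union (A A' : D.alg) :
    p D R ⟨A.1 ∪ A'.1, .union A.2 A'.2⟩ =
      p D R A + p D R A' - p D R ⟨A.1 ∩ A'.1, .inter A.2 A'.2⟩ := by
  refine (proj_eq (Rel.union A.1 A'.1 A.2 A'.2)).trans ?_
  rw [map_sub, map_add]
  rfl

theorem p_s_mul_t (e : E) : p D R ⟨D.s e, D.s_mem_alg e⟩ * t D R e = t D R e :=
  (map_mul _ _ _).symm.trans (proj_eq (Rel.source_edge e))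

theorem t_mul_p_r (e : E) : t D R e * p D R ⟨D.r e, D.r_mem_alg e⟩ = t D R e :=
  (map_mul _ _ _).symm.trans (proj_eq (Rel.edge_range e))

theorem p_r_mul_tStar (e : E) :
    p D R ⟨D.r e, D.r_mem_alg e⟩ * tStar D R e = tStar D R e :=
  (map_mul _ _ _).symm.trans (proj_eq (Rel.range_ghost e))

theorem tStar_mul_p_s (e : E) :
    tStar D R e * p D R ⟨D.s e, D.s_mem_alg e⟩ = tStar D R e :=
  (map_mul _ _ _).symm.trans (proj_eq (Rel.ghost_source e))

theorem tStar_mul_t (e : E) : tStar D R e * t D R e = p D R ⟨D.r e, D.r_mem_alg e⟩ :=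
  (map_mul _ _ _).symm.trans (proj_eq (Rel.ghost_edge e))

theorem tStar_mul_t_of_ne {e f : E} (h : e ≠ f) : tStar D R e * t D R f = 0 :=
  (map_mul _ _ _).symm.trans ((proj_eq (Rel.ghost_edge_ne e f h)).trans (map_zero _))

theorem p_vert (v : B) (hv : v ∈ D.vert) (hne : {e | D.s e = v}.Nonempty)
    (hfin : {e | D.s e = v}.Finite) :
    p D R ⟨v, D.vert_mem_alg hv⟩ = ∑ e ∈ hfin.toFinset, t D R e * tStar D R e := by
  refine (proj_eq (Rel.vertex v hv hne hfin)).trans ?_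
  simp only [map_sum, map_mul]
  rfl

/-- The elements of the algebra, the edges and the ghost edges generate. -/
theorem induction {C : D.LeavittAlgebra R → Prop} (hp : ∀ A, C (p D R A))
    (ht : ∀ e, C (t D R e)) (hts : ∀ e, C (tStar D R e)) (zero : C 0)
    (add : ∀ x y, C x → C y → C (x + y)) (smul : ∀ (c : R) x, C x → C (c • x))
    (mul : ∀ x y, C x → C y → C (x * y)) (x : D.LeavittAlgebra R) : C x := by
  obtain ⟨x, rfl⟩ := proj_surjective D R x
  have hl : ∀ l, C (proj D R (Free.letter D R l)) := by
    rintro (A | e | e)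
    exacts [hp A, ht e, hts e]
  induction x using MonoidAlgebra.induction_linear with
  | zero => simpa using zero
  | add f g hf hg =>
    rw [map_add]
    exact add _ _ hf hg
  | single w c =>
    have h : (MonoidAlgebra.single w c : D.Free R) = c • MonoidAlgebra.single w 1 := by simp
    rw [h, map_smul]
    refine smul _ _ ?_
    induction w using FreeSemigroup.recOnMul with
    | ih1 l => exact hl l
    | ih2 l w _ hw =>
      have h : (MonoidAlgebra.single (FreeSemigroup.of l * w) 1 : D.Free R) =
          Free.letter D R l * MonoidAlgebra.single w 1 := by
        simp [Free.letter, MonoidAlgebra.single_mul_single]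
      rw [h, map_mul]
      exact mul _ _ (hl l) (hw (by simp))

end LeavittAlgebra

variable (D) in
/-- A Leavitt family in a ring `Q`: elements which satisfy the defining relations of the Leavitt
path algebra. -/
structure LeavittFamily (Q : Type*) [NonUnitalRing Q] where
  p : ∀ A ∈ D.alg, Q
  t : E → Q
  tStar : E → Q
  p_empty : p ∅ .empty = 0
  p_inter : ∀ A A' h h', p A h * p A' h' = p (A ∩ A') (.inter h h')
  p_union : ∀ A A' h h', p (A ∪ A') (.union h h') = p A h + p A' h' - p (A ∩ A') (.inter h h')
  p_s_mul_t : ∀ e, p (D.s e) (D.s_mem_alg e) * t e = t e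
  t_mul_p_r : ∀ e, t e * p (D.r e) (D.r_mem_alg e) = t e
  p_r_mul_tStar : ∀ e, p (D.r e) (D.r_mem_alg e) * tStar e = tStar e
  tStar_mul_p_s : ∀ e, tStar e * p (D.s e) (D.s_mem_alg e) = tStar e
  tStar_mul_t : ∀ e, tStar e * t e = p (D.r e) (D.r_mem_alg e)
  tStar_mul_t_of_ne : ∀ e f, e ≠ f → tStar e * t f = 0
  p_vert : ∀ v (hv : v ∈ D.vert), {e | D.s e = v}.Nonempty → ∀ hfin : {e | D.s e = v}.Finite,
    p v (D.vert_mem_alg hv) = ∑ e ∈ hfin.toFinset, t e * tStar e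

namespace LeavittFamily

variable {Q : Type*} [NonUnitalRing Q] [Module R Q] [IsScalarTower R Q Q] [SMulCommClass R Q Q]
  (F : LeavittFamily D Q)

/-- The value of a Leavitt family on a letter. -/
def letter : D.Letter → Q
  | .set A => F.p A.1 A.2
  | .edge e => F.t e
  | .ghost e => F.tStar e

variable (R) in
/-- The homomorphism from the free algebra that belongs to a Leavitt family. -/
def freeLift : D.Free R →ₙₐ[R] Q :=
  MonoidAlgebra.liftMagma R (FreeSemigroup.lift F.letter)

theorem freeLift_letter (l : D.Letter) : F.freeLift R (Free.letter D R l) = F.letter l := by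
  simp [freeLift, Free.letter]

theorem freeLift_rel {x y : D.Free R} (h : Rel D R x y) : F.freeLift R x = F.freeLift R y := by
  cases h <;> simp only [map_mul, map_add, map_sub, map_zero, map_sum, freeLift_letter, letter]
  case empty => exact F.p_empty
  case inter => exact F.p_inter ..
  case union => exact F.p_union ..
  case source_edge => exact F.p_s_mul_t _
  case edge_range => exact F.t_mul_p_r _
  case range_ghost => exact F.p_r_mul_tStar _
  case ghost_source => exact F.tStar_mul_p_s _
  case ghost_edge => exact F.tStar_mul_t _
  case ghost_edge_ne h => exact F.tStar_mul_t_of_ne _ _ h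
  case vertex hv hne hfin => exact F.p_vert _ hv hne hfin

theorem freeLift_eq_zero {x : D.Free R} (h : x ∈ relIdeal R (Rel D R)) :
    F.freeLift R x = 0 := by
  rw [relIdeal, TwoSidedIdeal.mem_sInf] at h
  refine (TwoSidedIdeal.mem_ker (F.freeLift R)).1 (h (TwoSidedIdeal.ker (F.freeLift R)) ⟨⟨?_⟩, ?_⟩)
  · intro c x hx
    rw [TwoSidedIdeal.mem_ker] at hx ⊢
    rw [map_smul, hx, smul_zero]
  · intro x y hxy
    rw [TwoSidedIdeal.mem_ker, map_sub, F.freeLift_rel hxy, sub_self]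

variable (R) in
/-- The universal property of the Leavitt path algebra. -/
def lift : D.LeavittAlgebra R →ₙₐ[R] Q where
  toFun := Quotient.lift (F.freeLift R) fun x y h => by
    rw [← sub_eq_zero, ← map_sub]
    exact F.freeLift_eq_zero ((IdealQuotient.mk_eq_mk (relIdeal R (Rel D R))).1 (Quotient.sound h))
  map_zero' := map_zero (F.freeLift R)
  map_add' x y := by
    obtain ⟨x, rfl⟩ := LeavittAlgebra.proj_surjective D R x
    obtain ⟨y, rfl⟩ := LeavittAlgebra.proj_surjective D R y
    exact map_add (F.freeLift R) x y
  map_mul' x y := by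
    obtain ⟨x, rfl⟩ := LeavittAlgebra.proj_surjective D R x
    obtain ⟨y, rfl⟩ := LeavittAlgebra.proj_surjective D R y
    exact map_mul (F.freeLift R) x y
  map_smul' c x := by
    obtain ⟨x, rfl⟩ := LeavittAlgebra.proj_surjective D R x
    exact map_smul (F.freeLift R) c x

@[simp]
theorem lift_p (A : D.alg) : F.lift R (LeavittAlgebra.p D R A) = F.p A.1 A.2 :=
  F.freeLift_letter _

@[simp]
theorem lift_t (e : E) : F.lift R (LeavittAlgebra.t D R e) = F.t e :=
  F.freeLift_letter _

@[simp]
theorem lift_tStar (e : E) : F.lift R (LeavittAlgebra.tStar D R e) = F.tStar e :=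
  F.freeLift_letter _

end LeavittFamily

end UltragraphData

/-! ### Faithful representations on spaces of functions -/

namespace UltragraphData

variable {B E : Type*} [EmptyCollection B] [Union B] [Inter B] [SDiff B]
  {D : UltragraphData B E} {X : Type*} {R : Type*} [CommRing R]

variable (D X) in
/-- A faithful model of the collection `B` by subsets of a set `X`, such that the vertices are
atoms of `B` and no edge has an empty range. -/
structure SetModel where
  toSet : B → Set X
  injective : Function.Injective toSet
  map_empty : toSet ∅ = ∅
  map_union : ∀ A A', toSet (A ∪ A') = toSet A ∪ toSet A'
  map_inter : ∀ A A', toSet (A ∩ A') = toSet A ∩ toSet A'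
  map_sdiff : ∀ A A', toSet (A \ A') = toSet A \ toSet A'
  vert_ne : ∀ v ∈ D.vert, v ≠ ∅
  vert_inter : ∀ v ∈ D.vert, ∀ A : B, v ∩ A = ∅ ∨ v ∩ A = v
  r_ne : ∀ e, D.r e ≠ ∅

variable (R) in
/-- Restriction of functions to a set, as a linear map. -/
def indicator {Y : Type*} (S : Set Y) : Module.End R (Y → R) where
  toFun g := S.indicator g
  map_add' := Set.indicator_add' S
  map_smul' c g := Set.indicator_const_smul S c g

variable (R) in
/-- Transport of functions along an injection, continued by zero. -/
def push {Z Y : Type*} (i : Z → Y) : (Z → R) →ₗ[R] (Y → R) where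
  toFun g := Function.extend i g 0
  map_add' g g' := by
    simpa using Function.extend_add i g g' 0 0
  map_smul' c g := by
    simpa using Function.extend_smul c i g 0

namespace SetModel

variable (M : SetModel D X)

include M

theorem nonempty {A : B} (h : A ≠ ∅) : (M.toSet A).Nonempty := by
  rw [Set.nonempty_iff_ne_empty, ← M.map_empty]
  exact fun h' => h (M.injective h')

theorem inter_comm (A A' : B) : A ∩ A' = A' ∩ A :=
  M.injective (by rw [M.map_inter, M.map_inter, Set.inter_comm])

theorem vert_inter_vert {v w : B} (hv : v ∈ D.vert) (hw : w ∈ D.vert) (h : v ≠ w) :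
    v ∩ w = ∅ := by
  rcases M.vert_inter v hv w with h1 | h1
  · exact h1
  rcases M.vert_inter w hw v with h2 | h2
  · rw [M.inter_comm, h2]
  · rw [M.inter_comm, h1] at h2
    exact absurd h2 h

/-- The points of the space on which the Leavitt path algebra is represented. The second factor
makes room for the ranges of any number of edges inside a single vertex. -/
abbrev Point (_ : SetModel D X) : Type _ := X × List (E ⊕ X)

/-- By the Schröder-Bernstein theorem, the disjoint union of the ranges of the edges emitted by a
vertex `v` is in bijection with `v`, once points are multiplied with lists. -/
theorem exists_bijOn (v : B) (hv : v ∈ D.vert) (hne : {e | D.s e = v}.Nonempty) :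
    ∃ f : E × M.Point → M.Point,
      Set.BijOn f {z | D.s z.1 = v ∧ z.2.1 ∈ M.toSet (D.r z.1)} {y | y.1 ∈ M.toSet v} := by
  obtain ⟨e₀, he₀⟩ := hne
  obtain ⟨x₀, hx₀⟩ := M.nonempty (M.r_ne e₀)
  obtain ⟨x₁, hx₁⟩ := M.nonempty (M.vert_ne v hv)
  let S : Set (E × M.Point) := {z | D.s z.1 = v ∧ z.2.1 ∈ M.toSet (D.r z.1)}
  let S' : Set M.Point := {y | y.1 ∈ M.toSet v}
  let i : S → S' := fun z => ⟨(x₁, .inl z.1.1 :: .inr z.1.2.1 :: z.1.2.2), hx₁⟩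
  let j : S' → S := fun y => ⟨(e₀, (x₀, .inr y.1.1 :: y.1.2)), he₀, hx₀⟩
  have hi : Function.Injective i := by
    rintro ⟨⟨e, x, l⟩, _⟩ ⟨⟨e', x', l'⟩, _⟩ h
    simp only [i, Subtype.mk.injEq, Prod.mk.injEq, List.cons.injEq, Sum.inl.injEq,
      Sum.inr.injEq, true_and] at h
    obtain ⟨rfl, rfl, rfl⟩ := h
    rfl
  have hj : Function.Injective j := by
    rintro ⟨⟨x, l⟩, _⟩ ⟨⟨x', l'⟩, _⟩ h
    simp only [j, Subtype.mk.injEq, Prod.mk.injEq, List.cons.injEq, Sum.inr.injEq,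
      true_and] at h
    obtain ⟨rfl, rfl⟩ := h
    rfl
  obtain ⟨b, hb⟩ := Function.Embedding.schroeder_bernstein hi hj
  classical
  refine ⟨fun z => if h : z ∈ S then (b ⟨z, h⟩).1 else z.2, ?_, ?_, ?_⟩
  · intro z hz
    have hz' : z ∈ S := hz
    simp only [hz', dif_pos]
    exact (b ⟨z, hz'⟩).2
  · intro z hz z' hz' h
    have h1 : z ∈ S := hz
    have h2 : z' ∈ S := hz'
    simp only [h1, h2, dif_pos] at h
    exact congrArg Subtype.val (hb.1 (Subtype.ext h))
  · intro y hy
    obtain ⟨z, hz⟩ := hb.2 ⟨y, hy⟩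
    refine ⟨z.1, z.2, ?_⟩
    simp only [z.2, dif_pos]
    exact congrArg Subtype.val hz

/-- Every edge acts as an injection of its range into its source; the images are disjoint, and
they exhaust each vertex which emits edges. -/
theorem exists_branching : ∃ σ : E → M.Point → M.Point,
    (∀ e y, y.1 ∈ M.toSet (D.r e) → (σ e y).1 ∈ M.toSet (D.s e)) ∧
    (∀ e f y y', y.1 ∈ M.toSet (D.r e) → y'.1 ∈ M.toSet (D.r f) → σ e y = σ f y' →
      e = f ∧ y = y') ∧
    (∀ v ∈ D.vert, {e | D.s e = v}.Nonempty → ∀ y : M.Point, y.1 ∈ M.toSet v →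
      ∃ e, D.s e = v ∧ ∃ y', y'.1 ∈ M.toSet (D.r e) ∧ σ e y' = y) := by
  have : Nonempty (E × M.Point → M.Point) := ⟨Prod.snd⟩
  choose! f hf using M.exists_bijOn
  have hf' := fun e => hf (D.s e) (D.s_mem e) ⟨e, rfl⟩
  have hmaps : ∀ e y, y.1 ∈ M.toSet (D.r e) → (f (D.s e) (e, y)).1 ∈ M.toSet (D.s e) :=
    fun e y hy => (hf' e).mapsTo ⟨rfl, hy⟩
  refine ⟨fun e y => f (D.s e) (e, y), hmaps, ?_, ?_⟩
  · intro e e' y y' hy hy' h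
    have hs : D.s e = D.s e' := by
      by_contra hne
      have h1 := hmaps e y hy
      have h2 := hmaps e' y' hy'
      rw [← show f (D.s e) (e, y) = f (D.s e') (e', y') from h] at h2
      have h3 := M.map_inter (D.s e) (D.s e')
      rw [M.vert_inter_vert (D.s_mem e) (D.s_mem e') hne, M.map_empty] at h3
      exact Set.notMem_empty _ (h3.symm.subset ⟨h1, h2⟩)
    simp only [← hs] at h
    have := (hf' e).injOn (x₁ := (e, y)) (x₂ := (e', y')) ⟨rfl, hy⟩ ⟨hs.symm, hy'⟩ h
    exact Prod.mk.inj this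
  · intro v hv hne y hy
    obtain ⟨⟨e, y'⟩, ⟨h1, h2⟩, h3⟩ := (hf v hv hne).surjOn hy
    obtain rfl : D.s e = v := h1
    exact ⟨e, rfl, y', h2, h3⟩

/-- The space of functions on the points carries a Leavitt family. -/
theorem exists_family : ∃ F : LeavittFamily D (Module.End R (M.Point → R)),
    ∀ A h, F.p A h = indicator R {y : M.Point | y.1 ∈ M.toSet A} := by
  classical
  obtain ⟨σ, hmaps, hinj, hsurj⟩ := M.exists_branching
  let i (e : E) : {y : M.Point // y.1 ∈ M.toSet (D.r e)} → M.Point := fun y => σ e y.1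
  have hi : ∀ e, Function.Injective (i e) :=
    fun e y y' h => Subtype.ext (hinj e e _ _ y.2 y'.2 h).2
  let P (A : B) : Module.End R (M.Point → R) := indicator R {y | y.1 ∈ M.toSet A}
  let T (e : E) : Module.End R (M.Point → R) :=
    push R (i e) ∘ₗ LinearMap.funLeft R R Subtype.val
  let T' (e : E) : Module.End R (M.Point → R) :=
    indicator R {y | y.1 ∈ M.toSet (D.r e)} ∘ₗ LinearMap.funLeft R R (σ e)
  have hP : ∀ A (g : M.Point → R) y, P A g y = if y.1 ∈ M.toSet A then g y else 0 :=
    fun A g y => Set.indicator_apply {y : M.Point | y.1 ∈ M.toSet A} g y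
  have hT' : ∀ e (g : M.Point → R) y, T' e g y = if y.1 ∈ M.toSet (D.r e) then g (σ e y) else 0 :=
    fun e g y => Set.indicator_apply {y : M.Point | y.1 ∈ M.toSet (D.r e)} (fun y => g (σ e y)) y
  have hT : ∀ e (g : M.Point → R) y, y.1 ∈ M.toSet (D.r e) → T e g (σ e y) = g y :=
    fun e g y hy => (hi e).extend_apply (fun y => g y.1) 0 ⟨y, hy⟩
  have hT0 : ∀ e (g : M.Point → R) y, (∀ y', y'.1 ∈ M.toSet (D.r e) → σ e y' ≠ y) → T e g y = 0 :=
    fun e g y h => Function.extend_apply' (fun y : {y : M.Point // y.1 ∈ M.toSet (D.r e)} => g y.1)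
      (0 : M.Point → R) y
      fun ⟨a, ha⟩ => h a.1 a.2 ha
  have hTc : ∀ e y, (∃ y', y'.1 ∈ M.toSet (D.r e) ∧ σ e y' = y) ∨
      (∀ y', y'.1 ∈ M.toSet (D.r e) → σ e y' ≠ y) := by
    intro e y
    by_cases h : ∃ y', y'.1 ∈ M.toSet (D.r e) ∧ σ e y' = y
    · exact .inl h
    · exact .inr fun y' hy' h' => h ⟨y', hy', h'⟩
  refine ⟨{
    p := fun A _ => P A
    t := T
    tStar := T'
    p_empty := ?_
    p_inter := ?_
    p_union := ?_
    p_s_mul_t := ?_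
    t_mul_p_r := ?_
    p_r_mul_tStar := ?_
    tStar_mul_p_s := ?_
    tStar_mul_t := ?_
    tStar_mul_t_of_ne := ?_
    p_vert := ?_ }, fun A h => rfl⟩
  · refine LinearMap.ext fun g => funext fun y => ?_
    simp [hP, M.map_empty]
  · intro A A' _ _
    refine LinearMap.ext fun g => funext fun y => ?_
    by_cases h : y.1 ∈ M.toSet A <;> simp [hP, M.map_inter, h]
  · intro A A' _ _
    refine LinearMap.ext fun g => funext fun y => ?_
    by_cases h : y.1 ∈ M.toSet A <;> by_cases h' : y.1 ∈ M.toSet A' <;>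
      simp [hP, M.map_inter, M.map_union, h, h']
  · intro e
    refine LinearMap.ext fun g => funext fun y => ?_
    rw [Module.End.mul_apply, hP]
    rcases hTc e y with ⟨y', h1, rfl⟩ | h
    · rw [if_pos (hmaps e y' h1)]
    · rw [hT0 e g y h, ite_self]
  · intro e
    refine LinearMap.ext fun g => funext fun y => ?_
    rw [Module.End.mul_apply]
    rcases hTc e y with ⟨y', h1, rfl⟩ | h
    · rw [hT e _ y' h1, hT e _ y' h1, hP, if_pos h1]
    · rw [hT0 e _ y h, hT0 e _ y h]
  · intro e
    refine LinearMap.ext fun g => funext fun y => ?_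
    rw [Module.End.mul_apply, hP, hT']
    split_ifs <;> rfl
  · intro e
    refine LinearMap.ext fun g => funext fun y => ?_
    rw [Module.End.mul_apply, hT', hT', hP]
    split_ifs with h1 h2
    · rfl
    · exact absurd (hmaps e y h1) h2
    · rfl
  · intro e
    refine LinearMap.ext fun g => funext fun y => ?_
    rw [Module.End.mul_apply, hT', hP]
    split_ifs with h
    · exact hT e g y h
    · rfl
  · intro e f hef
    refine LinearMap.ext fun g => funext fun y => ?_
    rw [Module.End.mul_apply, hT']
    split_ifs with h
    · exact hT0 _ _ _ fun y' hy' h' => hef (hinj f e y' y hy' h h').1.symm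
    · rfl
  · intro v hv hne hfin
    refine LinearMap.ext fun g => funext fun y => ?_
    rw [LinearMap.sum_apply, Finset.sum_apply, hP]
    split_ifs with h
    · obtain ⟨e, he, y', hy', rfl⟩ := hsurj v hv hne y h
      rw [Finset.sum_eq_single e]
      · rw [Module.End.mul_apply, hT e _ y' hy', hT', if_pos hy']
      · intro f _ hfe
        exact hT0 _ _ _ fun y₁ hy₁ h' => hfe (hinj f e y₁ y' hy₁ hy' h').1
      · intro h'
        exact absurd (hfin.mem_toFinset.2 he) h'
    · refine (Finset.sum_eq_zero fun e he => hT0 _ _ _ fun y' hy' h' => h ?_).symm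
      rw [← (hfin.mem_toFinset.1 he : D.s e = v), ← h']
      exact hmaps e y' hy'

/-- Non-zero multiples of the idempotents of non-empty elements do not vanish. -/
theorem smul_p_eq_zero {A : D.alg} {c : R} (h : c • LeavittAlgebra.p D R A = 0) :
    c = 0 ∨ A.1 = ∅ := by
  by_contra! hc
  obtain ⟨x, hx⟩ := M.nonempty hc.2
  obtain ⟨F, hF⟩ := M.exists_family (R := R)
  have h1 := congrArg (F.lift R) h
  rw [map_smul, F.lift_p, map_zero, hF] at h1
  have h2 := congrFun (LinearMap.congr_fun h1 (fun _ => 1)) (x, [])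
  have h3 : indicator R {y : M.Point | y.1 ∈ M.toSet A.1} (fun _ => (1 : R)) (x, []) = 1 :=
    Set.indicator_of_mem (s := {y : M.Point | y.1 ∈ M.toSet A.1}) (a := (x, [])) hx fun _ => (1 : R)
  refine hc.1 ?_
  rw [LinearMap.smul_apply, Pi.smul_apply, h3, smul_eq_mul, mul_one] at h2
  exact h2

end SetModel

end UltragraphData

/-! ### Graded uniqueness -/

namespace UltragraphData

variable {B E : Type*} [EmptyCollection B] [Union B] [Inter B] [SDiff B]
  {D : UltragraphData B E} {X : Type*} {R : Type*} [CommRing R]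

namespace LeavittAlgebra

variable (D R) in
/-- The span of the elements `s_α p_A` for words `α` of `m` edges. -/
def realPart : ℕ → Submodule R (D.LeavittAlgebra R)
  | 0 => Submodule.span R (Set.range (p D R))
  | m + 1 => Submodule.span R {x | ∃ e, ∃ y ∈ realPart m, x = t D R e * y}

variable (D R) in
/-- The spaces `realPart`, with zero as the part of negative degree. -/
def realPartInt (m : ℤ) : Submodule R (D.LeavittAlgebra R) :=
  if 0 ≤ m then realPart D R m.toNat else ⊥

variable (D R) in
/-- The span of the elements `s_α p_A s_{β^*}` of degree `m` in which `β` is a word of at most `N`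
edges. -/
def degreePart : ℤ → ℕ → Submodule R (D.LeavittAlgebra R)
  | m, 0 => realPartInt D R m
  | m, N + 1 => realPartInt D R m ⊔
      Submodule.span R {x | ∃ e, ∃ y ∈ degreePart (m + 1) N, x = y * tStar D R e}

theorem exists_sum_of_mem_span {L : Type*} [AddCommGroup L] [Module R L] (g : E → L →ₗ[R] L)
    (N : Submodule R L) {x : L} (hx : x ∈ Submodule.span R {x | ∃ e, ∃ y ∈ N, x = g e y}) :
    ∃ (F : Finset E) (f : E → L), (∀ e, f e ∈ N) ∧ x = ∑ e ∈ F, g e (f e) := by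
  suffices h : ∃ f : E →₀ L, (∀ e, f e ∈ N) ∧ x = f.sum fun e y => g e y by
    obtain ⟨f, hf, rfl⟩ := h
    exact ⟨f.support, f, hf, rfl⟩
  classical
  induction hx using Submodule.span_induction with
  | mem x h =>
    obtain ⟨e, y, hy, rfl⟩ := h
    refine ⟨Finsupp.single e y, fun e' => ?_,
      (Finsupp.sum_single_index (h := fun e y => g e y) (map_zero _)).symm⟩
    rw [Finsupp.single_apply]
    split_ifs
    exacts [hy, N.zero_mem]
  | zero => exact ⟨0, fun _ => N.zero_mem, rfl⟩
  | add x y _ _ hx hy =>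
    obtain ⟨f, hf, rfl⟩ := hx
    obtain ⟨f', hf', rfl⟩ := hy
    exact ⟨f + f', fun e => N.add_mem (hf e) (hf' e),
      (Finsupp.sum_add_index' (fun _ => map_zero _) fun _ _ _ => map_add _ _ _).symm⟩
  | smul c x _ hx =>
    obtain ⟨f, hf, rfl⟩ := hx
    refine ⟨c • f, fun e => N.smul_mem c (hf e), ?_⟩
    rw [Finsupp.sum_smul_index' fun _ => map_zero _, Finsupp.smul_sum]
    simp only [map_smul]

theorem p_mem_realPart (A : D.alg) : p D R A ∈ realPart D R 0 :=
  Submodule.subset_span ⟨A, rfl⟩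

theorem p_mem_degreePart (A : D.alg) : p D R A ∈ degreePart D R 0 0 :=
  p_mem_realPart A

theorem realPartInt_le_degreePart (m : ℤ) (N : ℕ) :
    realPartInt D R m ≤ degreePart D R m N := by
  cases N with
  | zero => exact le_rfl
  | succ N => exact le_sup_left

theorem mul_tStar_mem_degreePart {m : ℤ} {N : ℕ} {x : D.LeavittAlgebra R}
    (hx : x ∈ degreePart D R m N) (e : E) :
    x * tStar D R e ∈ degreePart D R (m - 1) (N + 1) := by
  refine Submodule.mem_sup_right (Submodule.subset_span ⟨e, x, ?_, rfl⟩)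
  rwa [sub_add_cancel]

theorem degreePart_induction {m : ℤ} {N : ℕ} (S : Submodule R (D.LeavittAlgebra R))
    (h1 : ∀ x ∈ realPartInt D R m, x ∈ S)
    (h2 : ∀ e, ∀ y ∈ degreePart D R (m + 1) N, y * tStar D R e ∈ S) :
    degreePart D R m (N + 1) ≤ S := by
  refine sup_le h1 (Submodule.span_le.2 ?_)
  rintro _ ⟨e, y, hy, rfl⟩
  exact h2 e y hy

theorem t_mul_mem_degreePart (e : E) (m : ℤ) (N : ℕ) :
    degreePart D R m N ≤
      (degreePart D R (m + 1) N).comap (LinearMap.mulLeft R (t D R e)) := by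
  have h0 : ∀ m, ∀ x ∈ realPartInt D R m, t D R e * x ∈ realPartInt D R (m + 1) := by
    intro m x hx
    unfold realPartInt at hx ⊢
    split_ifs at hx with h
    · rw [if_pos (by omega), Int.toNat_add h zero_le_one]
      exact Submodule.subset_span ⟨e, x, hx, rfl⟩
    · rw [(Submodule.mem_bot R).1 hx, mul_zero]
      exact zero_mem _
  induction N generalizing m with
  | zero => exact h0 m
  | succ N ih =>
    refine degreePart_induction _ (fun x hx => Submodule.mem_sup_left (h0 m x hx)) ?_
    intro f y hy
    refine Submodule.mem_sup_right (Submodule.subset_span ⟨f, t D R e * y, ih _ hy, ?_⟩)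
    exact (mul_assoc _ _ _).symm

theorem degreePart_le_succ (m : ℤ) (N : ℕ) :
    degreePart D R m N ≤ degreePart D R m (N + 1) := by
  induction N generalizing m with
  | zero => exact le_sup_left
  | succ N ih =>
    refine degreePart_induction _ (fun x hx => Submodule.mem_sup_left hx) ?_
    intro f y hy
    exact Submodule.mem_sup_right (Submodule.subset_span ⟨f, y, ih _ hy, rfl⟩)

theorem degreePart_mono (m : ℤ) : Monotone (degreePart D R m) :=
  monotone_nat_of_le_succ (degreePart_le_succ m)

end LeavittAlgebra

open LeavittAlgebra

namespace SetModel

variable (M : SetModel D X)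

include M

theorem p_inter_add_p_sdiff (A A' : D.alg) :
    p D R ⟨A.1 ∩ A'.1, .inter A.2 A'.2⟩ + p D R ⟨A.1 \ A'.1, .sdiff A.2 A'.2⟩ = p D R A := by
  have h := p_union (R := R) (D := D) ⟨A.1 ∩ A'.1, .inter A.2 A'.2⟩ ⟨A.1 \ A'.1, .sdiff A.2 A'.2⟩
  have h1 : (A.1 ∩ A'.1) ∪ (A.1 \ A'.1) = A.1 := M.injective (by
    rw [M.map_union, M.map_inter, M.map_sdiff, Set.inter_union_sdiff])
  have h2 : (A.1 ∩ A'.1) ∩ (A.1 \ A'.1) = ∅ := M.injective (by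
    rw [M.map_inter, M.map_inter, M.map_sdiff, M.map_empty]
    ext x
    simp only [Set.mem_inter_iff, Set.mem_sdiff, Set.mem_empty_iff_false]
    tauto)
  simp only [h1, h2, p_empty, sub_zero] at h
  exact h.symm

theorem p_mul_p_comm (A A' : D.alg) : p D R A * p D R A' = p D R A' * p D R A := by
  rw [p_mul_p, p_mul_p]
  simp only [M.inter_comm]

theorem p_mul_p_of_subset {A A' : D.alg} (h : M.toSet A.1 ⊆ M.toSet A'.1) :
    p D R A * p D R A' = p D R A := by
  rw [p_mul_p]
  congr 2
  exact M.injective (by rw [M.map_inter, Set.inter_eq_self_of_subset_left h])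

theorem vert_mul_p {v : B} (hv : v ∈ D.vert) (A : D.alg) :
    p D R ⟨v, D.vert_mem_alg hv⟩ * p D R A = 0 ∨
      p D R ⟨v, D.vert_mem_alg hv⟩ * p D R A = p D R ⟨v, D.vert_mem_alg hv⟩ := by
  rw [p_mul_p]
  rcases M.vert_inter v hv A.1 with h | h
  · left
    simp only [h, p_empty]
  · right
    simp only [h]

theorem p_mul_t (A : D.alg) (e : E) : p D R A * t D R e = 0 ∨ p D R A * t D R e = t D R e := by
  rw [← p_s_mul_t, ← mul_assoc, M.p_mul_p_comm]
  rcases M.vert_mul_p (R := R) (D.s_mem e) A with h | h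
  · left
    rw [h, zero_mul]
  · right
    rw [h]

theorem tStar_mul_p (A : D.alg) (e : E) :
    tStar D R e * p D R A = 0 ∨ tStar D R e * p D R A = tStar D R e := by
  rw [← tStar_mul_p_s, mul_assoc]
  rcases M.vert_mul_p (R := R) (D.s_mem e) A with h | h
  · left
    rw [h, mul_zero]
  · right
    rw [h]

theorem exists_right_unit (x : D.LeavittAlgebra R) : ∃ A, x * p D R A = x := by
  have mono : ∀ (A A' : D.alg) (y : D.LeavittAlgebra R), M.toSet A.1 ⊆ M.toSet A'.1 →
      y * p D R A = y → y * p D R A' = y := by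
    intro A A' y h hy
    rw [← hy, mul_assoc, M.p_mul_p_of_subset h]
  induction x using LeavittAlgebra.induction with
  | hp A => exact ⟨A, M.p_mul_p_of_subset subset_rfl⟩
  | ht e => exact ⟨_, t_mul_p_r e⟩
  | hts e => exact ⟨_, tStar_mul_p_s e⟩
  | zero => exact ⟨⟨∅, .empty⟩, zero_mul _⟩
  | add x y hx hy =>
    obtain ⟨A, hA⟩ := hx
    obtain ⟨A', hA'⟩ := hy
    refine ⟨⟨A.1 ∪ A'.1, .union A.2 A'.2⟩, ?_⟩
    rw [add_mul, mono A _ x (by rw [M.map_union]; exact Set.subset_union_left) hA,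
      mono A' _ y (by rw [M.map_union]; exact Set.subset_union_right) hA']
  | smul c x hx =>
    obtain ⟨A, hA⟩ := hx
    exact ⟨A, by rw [smul_mul_assoc, hA]⟩
  | mul x y _ hy =>
    obtain ⟨A, hA⟩ := hy
    exact ⟨A, by rw [mul_assoc, hA]⟩

theorem p_mul_mem_realPart (A : D.alg) {m : ℕ} {x : D.LeavittAlgebra R}
    (hx : x ∈ realPart D R m) : p D R A * x ∈ realPart D R m := by
  suffices h : realPart D R m ≤ (realPart D R m).comap (LinearMap.mulLeft R (p D R A)) from h hx
  cases m with
  | zero =>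
    refine Submodule.span_le.2 ?_
    rintro _ ⟨A', rfl⟩
    change p D R A * p D R A' ∈ realPart D R 0
    rw [p_mul_p]
    exact p_mem_realPart _
  | succ m =>
    refine Submodule.span_le.2 ?_
    rintro _ ⟨e, y, hy, rfl⟩
    change p D R A * (t D R e * y) ∈ realPart D R (m + 1)
    rw [← mul_assoc]
    rcases M.p_mul_t (R := R) A e with h | h <;> rw [h]
    · rw [zero_mul]
      exact zero_mem _
    · exact Submodule.subset_span ⟨e, y, hy, rfl⟩

omit M in
theorem realPart_mul_p (A : D.alg) {m : ℕ} {x : D.LeavittAlgebra R}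
    (hx : x ∈ realPart D R m) : x * p D R A ∈ realPart D R m := by
  suffices h : realPart D R m ≤ (realPart D R m).comap (LinearMap.mulRight R (p D R A)) from h hx
  clear hx
  induction m with
  | zero =>
    refine Submodule.span_le.2 ?_
    rintro _ ⟨A', rfl⟩
    change p D R A' * p D R A ∈ realPart D R 0
    rw [p_mul_p]
    exact p_mem_realPart _
  | succ m ih =>
    refine Submodule.span_le.2 ?_
    rintro _ ⟨e, y, hy, rfl⟩
    exact Submodule.subset_span ⟨e, y * p D R A, ih hy, mul_assoc _ _ _⟩

theorem realPart_mul_t (e : E) {m : ℕ} {x : D.LeavittAlgebra R}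
    (hx : x ∈ realPart D R m) : x * t D R e ∈ realPart D R (m + 1) := by
  suffices h : realPart D R m ≤ (realPart D R (m + 1)).comap (LinearMap.mulRight R (t D R e))
    from h hx
  clear hx
  induction m with
  | zero =>
    refine Submodule.span_le.2 ?_
    rintro _ ⟨A, rfl⟩
    change p D R A * t D R e ∈ realPart D R 1
    rcases M.p_mul_t (R := R) A e with h | h <;> rw [h]
    · exact zero_mem _
    · rw [← t_mul_p_r]
      exact Submodule.subset_span ⟨e, _, p_mem_realPart _, rfl⟩
  | succ m ih =>
    refine Submodule.span_le.2 ?_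
    rintro _ ⟨f, y, hy, rfl⟩
    exact Submodule.subset_span ⟨f, y * t D R e, ih hy, mul_assoc _ _ _⟩

omit M in
theorem realPartInt_mul_p (A : D.alg) {m : ℤ} {x : D.LeavittAlgebra R}
    (hx : x ∈ realPartInt D R m) : x * p D R A ∈ realPartInt D R m := by
  unfold realPartInt at hx ⊢
  split_ifs at hx ⊢
  · exact realPart_mul_p A hx
  · rw [(Submodule.mem_bot R).1 hx, zero_mul]
    exact zero_mem _

theorem realPartInt_mul_t (e : E) {m : ℤ} {x : D.LeavittAlgebra R}
    (hx : x ∈ realPartInt D R m) : x * t D R e ∈ realPartInt D R (m + 1) := by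
  unfold realPartInt at hx ⊢
  split_ifs at hx with h
  · rw [if_pos (by omega), Int.toNat_add h zero_le_one]
    exact M.realPart_mul_t e hx
  · rw [(Submodule.mem_bot R).1 hx, zero_mul]
    exact zero_mem _

theorem degreePart_mul_p (A : D.alg) {m : ℤ} {N : ℕ} {x : D.LeavittAlgebra R}
    (hx : x ∈ degreePart D R m N) : x * p D R A ∈ degreePart D R m N := by
  cases N with
  | zero => exact realPartInt_mul_p A hx
  | succ N =>
    refine degreePart_induction ((degreePart D R m (N + 1)).comap
      (LinearMap.mulRight R (p D R A))) ?_ ?_ hx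
    · intro x hx
      exact Submodule.mem_sup_left (realPartInt_mul_p A hx)
    · intro e y hy
      change y * tStar D R e * p D R A ∈ degreePart D R m (N + 1)
      rw [mul_assoc]
      rcases M.tStar_mul_p (R := R) A e with h | h <;> rw [h]
      · rw [mul_zero]
        exact zero_mem _
      · exact Submodule.mem_sup_right (Submodule.subset_span ⟨e, y, hy, rfl⟩)

theorem degreePart_mul_t (e : E) {m : ℤ} {N : ℕ} {x : D.LeavittAlgebra R}
    (hx : x ∈ degreePart D R m (N + 1)) : x * t D R e ∈ degreePart D R (m + 1) N := by
  refine degreePart_induction ((degreePart D R (m + 1) N).comap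
    (LinearMap.mulRight R (t D R e))) ?_ ?_ hx
  · intro x hx
    exact realPartInt_le_degreePart _ _ (M.realPartInt_mul_t e hx)
  · intro f y hy
    change y * tStar D R f * t D R e ∈ degreePart D R (m + 1) N
    rw [mul_assoc]
    rcases eq_or_ne f e with rfl | h
    · rw [tStar_mul_t]
      exact M.degreePart_mul_p _ hy
    · rw [tStar_mul_t_of_ne h, mul_zero]
      exact zero_mem _

section Ideal

variable {J : TwoSidedIdeal (D.LeavittAlgebra R)}
  (hJ : ∀ (A : D.alg) (c : R), c • p D R A ∈ J → c = 0 ∨ A.1 = ∅)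

include hJ

omit M in
theorem smul_p_eq_zero_of_mem {A : D.alg} {c : R} (h : c • p D R A ∈ J) :
    c • p D R A = 0 := by
  rcases hJ A c h with h | h
  · rw [h, zero_smul]
  · obtain ⟨A, hA⟩ := A
    obtain rfl : A = ∅ := h
    rw [p_empty, smul_zero]

theorem smul_t_eq_zero_of_mem {e : E} {c : R} (h : c • t D R e ∈ J) : c = 0 := by
  have h1 := J.mul_mem_left (tStar D R e) _ h
  rw [mul_smul_comm, tStar_mul_t] at h1
  exact (hJ _ c h1).resolve_right (M.r_ne e)

/-- A linear combination of idempotents `p_A` which lies in `J` vanishes: the Boolean algebra is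
cut into pieces on which the combination is a multiple of a single idempotent. -/
theorem eq_zero_of_mem_realPart_zero {x : D.LeavittAlgebra R} (hx : x ∈ realPart D R 0)
    (hxJ : x ∈ J) : x = 0 := by
  -- The additional summand `d • p_C` makes the induction on the number of summands work.
  let good (y : D.LeavittAlgebra R) : Prop := ∀ (C : D.alg) (d : R),
    y * p D R C + d • p D R C ∈ J → y * p D R C + d • p D R C = 0
  have hgood0 : good 0 := fun C d h => by
    rw [zero_mul, zero_add] at h ⊢
    exact smul_p_eq_zero_of_mem hJ h
  have key : ∀ (c : R) (y : D.LeavittAlgebra R), good y → good (y + c • x) := by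
    clear hxJ
    induction hx using Submodule.span_induction with
    | mem x h =>
      obtain ⟨A, rfl⟩ := h
      intro c y hy C d h
      let C₁ : D.alg := ⟨C.1 ∩ A.1, .inter C.2 A.2⟩
      let C₂ : D.alg := ⟨C.1 \ A.1, .sdiff C.2 A.2⟩
      have hC : p D R C₁ + p D R C₂ = p D R C := M.p_inter_add_p_sdiff C A
      have hsub₁ : M.toSet C₁.1 ⊆ M.toSet C.1 := by
        rw [M.map_inter]; exact Set.inter_subset_left
      have hsub₂ : M.toSet C₂.1 ⊆ M.toSet C.1 := by
        rw [M.map_sdiff]; exact Set.sdiff_subset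
      have hsubA : M.toSet C₁.1 ⊆ M.toSet A.1 := by
        rw [M.map_inter]; exact Set.inter_subset_right
      have hA2 : p D R A * p D R C₂ = 0 := by
        rw [p_mul_p]
        have : A.1 ∩ C₂.1 = ∅ := M.injective (by
          rw [M.map_inter, M.map_sdiff, M.map_empty, Set.inter_sdiff_self])
        simp only [this, p_empty]
      have hA1 : p D R A * p D R C₁ = p D R C₁ := by
        rw [M.p_mul_p_comm, M.p_mul_p_of_subset hsubA]
      have e1 : ((y + c • p D R A) * p D R C + d • p D R C) * p D R C₁ =
          y * p D R C₁ + (c + d) • p D R C₁ := by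
        simp only [add_mul, smul_mul_assoc, mul_assoc, M.p_mul_p_comm C C₁,
          M.p_mul_p_of_subset hsub₁, hA1, add_smul, add_assoc]
      have e2 : ((y + c • p D R A) * p D R C + d • p D R C) * p D R C₂ =
          y * p D R C₂ + d • p D R C₂ := by
        simp only [add_mul, smul_mul_assoc, mul_assoc, M.p_mul_p_comm C C₂,
          M.p_mul_p_of_subset hsub₂, hA2, smul_zero, add_zero]
      have z1 := hy C₁ (c + d) (e1 ▸ J.mul_mem_right _ (p D R C₁) h)
      have z2 := hy C₂ d (e2 ▸ J.mul_mem_right _ (p D R C₂) h)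
      have e3 : (y + c • p D R A) * p D R C + d • p D R C =
          ((y + c • p D R A) * p D R C + d • p D R C) * p D R C := by
        simp only [add_mul, smul_mul_assoc, mul_assoc, M.p_mul_p_of_subset (subset_refl
          (M.toSet C.1))]
      rw [e3, ← hC, mul_add, hC, e1, e2, z1, z2, add_zero]
    | zero =>
      intro c y hy
      rwa [smul_zero, add_zero]
    | add x x' _ _ hx hx' =>
      intro c y hy
      rw [smul_add, ← add_assoc]
      exact hx' c _ (hx c y hy)
    | smul c' x _ hx =>
      intro c y hy
      rw [smul_smul]
      exact hx _ y hy
  obtain ⟨A, hA⟩ := M.exists_right_unit x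
  have h := key 1 0 hgood0 A 0
  rw [one_smul, zero_add, zero_smul, add_zero, hA] at h
  exact h hxJ

theorem eq_zero_of_mem_realPart {m : ℕ} {x : D.LeavittAlgebra R} (hx : x ∈ realPart D R m)
    (hxJ : x ∈ J) : x = 0 := by
  classical
  induction m generalizing x with
  | zero => exact M.eq_zero_of_mem_realPart_zero hJ hx hxJ
  | succ m ih =>
    obtain ⟨F, f, hf, rfl⟩ := exists_sum_of_mem_span
      (fun e => LinearMap.mulLeft R (t D R e)) (realPart D R m) hx
    refine Finset.sum_eq_zero fun e he => ?_
    have h1 := J.mul_mem_left (tStar D R e) _ hxJ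
    rw [Finset.mul_sum, Finset.sum_eq_single_of_mem e he] at h1
    · simp only [LinearMap.mulLeft_apply, ← mul_assoc, tStar_mul_t] at h1 ⊢
      rw [← t_mul_p_r, mul_assoc, ih (M.p_mul_mem_realPart _ (hf e)) h1, mul_zero]
    · intro e' _ hne
      simp only [LinearMap.mulLeft_apply, ← mul_assoc, tStar_mul_t_of_ne hne.symm, zero_mul]

/-- If an element without ghost edges is annihilated by an edge `e`, then it is annihilated by
the source of `e`. -/
theorem realPart_mul_p_s (e : E) {m : ℕ} {x : D.LeavittAlgebra R} (hx : x ∈ realPart D R m)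
    (hxJ : x * t D R e ∈ J) : x * p D R ⟨D.s e, D.s_mem_alg e⟩ = 0 := by
  classical
  induction m generalizing x with
  | zero =>
    have : ∃ c : R, x * p D R ⟨D.s e, D.s_mem_alg e⟩ = c • p D R ⟨D.s e, D.s_mem_alg e⟩ := by
      clear hxJ
      induction hx using Submodule.span_induction with
      | mem x h =>
        obtain ⟨A, rfl⟩ := h
        rw [M.p_mul_p_comm]
        rcases M.vert_mul_p (R := R) (D.s_mem e) A with h | h
        · exact ⟨0, by rw [h, zero_smul]⟩
        · exact ⟨1, by rw [h, one_smul]⟩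
      | zero => exact ⟨0, by rw [zero_mul, zero_smul]⟩
      | add x y _ _ hx hy =>
        obtain ⟨c, hc⟩ := hx
        obtain ⟨d, hd⟩ := hy
        exact ⟨c + d, by rw [add_mul, hc, hd, add_smul]⟩
      | smul c' x _ hx =>
        obtain ⟨c, hc⟩ := hx
        exact ⟨c' * c, by rw [smul_mul_assoc, hc, smul_smul]⟩
    obtain ⟨c, hc⟩ := this
    rw [← p_s_mul_t, ← mul_assoc, hc, smul_mul_assoc, p_s_mul_t] at hxJ
    rw [hc, M.smul_t_eq_zero_of_mem hJ hxJ, zero_smul]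
  | succ m ih =>
    obtain ⟨F, f, hf, rfl⟩ := exists_sum_of_mem_span
      (fun e => LinearMap.mulLeft R (t D R e)) (realPart D R m) hx
    rw [Finset.sum_mul]
    refine Finset.sum_eq_zero fun e' he => ?_
    have h1 := J.mul_mem_left (tStar D R e') _ hxJ
    rw [Finset.sum_mul, Finset.mul_sum, Finset.sum_eq_single_of_mem e' he] at h1
    · simp only [LinearMap.mulLeft_apply, ← mul_assoc, tStar_mul_t] at h1 ⊢
      rw [← t_mul_p_r, mul_assoc (t D R e'), mul_assoc (t D R e'),
        ih (M.p_mul_mem_realPart _ (hf e')) h1, mul_zero]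
    · intro e' _ hne
      simp only [LinearMap.mulLeft_apply, ← mul_assoc, tStar_mul_t_of_ne hne.symm, zero_mul]

theorem eq_zero_of_mem_realPartInt {m : ℤ} {x : D.LeavittAlgebra R}
    (hx : x ∈ realPartInt D R m) (hxJ : x ∈ J) : x = 0 := by
  unfold realPartInt at hx
  split_ifs at hx
  · exact M.eq_zero_of_mem_realPart hJ hx hxJ
  · exact (Submodule.mem_bot R).1 hx

theorem realPartInt_mul_p_s (e : E) {m : ℤ} {x : D.LeavittAlgebra R}
    (hx : x ∈ realPartInt D R m) (hxJ : x * t D R e ∈ J) :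
    x * p D R ⟨D.s e, D.s_mem_alg e⟩ = 0 := by
  unfold realPartInt at hx
  split_ifs at hx
  · exact M.realPart_mul_p_s hJ e hx hxJ
  · rw [(Submodule.mem_bot R).1 hx, zero_mul]

/-- Graded uniqueness: an ideal which contains no non-zero multiples of idempotents `p_A` with
`A ≠ ∅` contains no non-zero homogeneous elements. -/
theorem eq_zero_of_mem_degreePart {m : ℤ} {N : ℕ} {x : D.LeavittAlgebra R}
    (hx : x ∈ degreePart D R m N) (hxJ : x ∈ J) : x = 0 := by
  classical
  induction N generalizing m x with
  | zero => exact M.eq_zero_of_mem_realPartInt hJ hx hxJ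
  | succ N ih =>
    have hxt : ∀ e, x * t D R e = 0 :=
      fun e => ih (M.degreePart_mul_t e hx) (J.mul_mem_right _ _ hxJ)
    obtain ⟨x₀, hx₀, x₁, hx₁, hsum⟩ := Submodule.mem_sup.1 hx
    obtain ⟨F, f, hf, rfl⟩ := exists_sum_of_mem_span
      (fun e => LinearMap.mulRight R (tStar D R e)) (degreePart D R (m + 1) N) hx₁
    simp only [LinearMap.mulRight_apply] at hsum
    -- The sources of the edges in `F` annihilate `x`.
    have hv : ∀ e₀ ∈ F, x * p D R ⟨D.s e₀, D.s_mem_alg e₀⟩ = 0 := by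
      intro e₀ he₀
      by_cases hfin : {e | D.s e = D.s e₀}.Finite
      · rw [p_vert _ (D.s_mem e₀) ⟨e₀, rfl⟩ hfin, Finset.mul_sum]
        exact Finset.sum_eq_zero fun e _ => by rw [← mul_assoc, hxt, zero_mul]
      · -- An edge outside `F` with the same source sees only the part without ghost edges.
        obtain ⟨e, he, heF⟩ := Set.Infinite.exists_notMem_finset hfin F
        have he : D.s e = D.s e₀ := he
        have h0 : x₀ * t D R e = 0 := by
          have h := hxt e
          rw [← hsum, add_mul, Finset.sum_mul, Finset.sum_eq_zero, add_zero] at h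
          · exact h
          · intro e' he'
            rw [mul_assoc, tStar_mul_t_of_ne (ne_of_mem_of_not_mem he' heF), mul_zero]
        have h1 := M.realPartInt_mul_p_s hJ e hx₀ (h0 ▸ J.zero_mem)
        simp only [he] at h1
        rw [← hsum, add_mul, h1, zero_add, Finset.sum_mul]
        refine Finset.sum_eq_zero fun e' he' => ?_
        by_cases hs : D.s e' = D.s e₀
        · have h2 : f e' * p D R ⟨D.r e', D.r_mem_alg e'⟩ = 0 := by
            have h := hxt e'
            have h3 : x₀ * t D R e' = 0 := by
              rw [← p_s_mul_t, ← mul_assoc]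
              simp only [hs, h1, zero_mul]
            rw [← hsum, add_mul, h3, zero_add, Finset.sum_mul, Finset.sum_eq_single_of_mem e' he',
              mul_assoc, tStar_mul_t] at h
            · exact h
            · intro e'' _ hne
              rw [mul_assoc, tStar_mul_t_of_ne hne, mul_zero]
          rw [← p_r_mul_tStar, ← mul_assoc, h2, zero_mul, zero_mul]
        · rw [← tStar_mul_p_s, mul_assoc, mul_assoc, p_mul_p]
          simp only [M.vert_inter_vert (D.s_mem e') (D.s_mem e₀) hs, p_empty, mul_zero]
    -- Off the sources of the edges in `F` only `x₀` survives; the sources are split off one by one.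
    have hA : ∀ F' : Finset E, F' ⊆ F → ∀ A : D.alg,
        (∀ e ∈ F, e ∉ F' → D.s e ∩ A.1 = ∅) → x * p D R A = 0 := by
      intro F'
      induction F' using Finset.induction_on with
      | empty =>
        intro _ A hA
        have h1 : x * p D R A = x₀ * p D R A := by
          rw [← hsum, add_mul, Finset.sum_mul, Finset.sum_eq_zero, add_zero]
          intro e he
          rw [← tStar_mul_p_s, mul_assoc, mul_assoc, p_mul_p]
          simp only [hA e he (Finset.notMem_empty e), p_empty, mul_zero]
        rw [h1]
        exact M.eq_zero_of_mem_realPartInt hJ (realPartInt_mul_p A hx₀)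
          (h1 ▸ J.mul_mem_right _ _ hxJ)
      | insert e F' _ ihF =>
        intro hF' A hA
        let v : D.alg := ⟨D.s e, D.s_mem_alg e⟩
        rw [← M.p_inter_add_p_sdiff A v, mul_add, ← p_mul_p, M.p_mul_p_comm, ← mul_assoc,
          hv e (hF' (Finset.mem_insert_self e F')), zero_mul, zero_add]
        refine ihF (fun a ha => hF' (Finset.mem_insert_of_mem ha)) _ fun e' he' he'F => ?_
        refine M.injective ?_
        rw [M.map_inter, M.map_sdiff, M.map_empty]
        by_cases h : e' = e
        · subst h
          exact Set.inter_sdiff_self _ _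
        · have h1 := hA e' he' (by simp [h, he'F])
          have h2 := M.map_inter (D.s e') A.1
          rw [h1, M.map_empty] at h2
          rw [← Set.inter_sdiff_assoc, ← h2, Set.empty_sdiff]
    obtain ⟨A, hxA⟩ := M.exists_right_unit x
    rw [← hxA]
    exact hA F subset_rfl A fun e he he' => absurd he he'

end Ideal

end SetModel

end UltragraphData

/-! ### The Boolean algebra of a quotient ultragraph -/

namespace Ultragraph

open UltragraphData

variable {V E : Type*} {G : Ultragraph V E}

theorem union_mem_sets {A A' : Set V} (h : A ∈ G.sets) (h' : A' ∈ G.sets) : A ∪ A' ∈ G.sets :=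
  AlgebraGen.union h h'

theorem inter_mem_sets {A A' : Set V} (h : A ∈ G.sets) (h' : A' ∈ G.sets) : A ∩ A' ∈ G.sets :=
  AlgebraGen.inter h h'

theorem sdiff_mem_sets {A A' : Set V} (h : A ∈ G.sets) (h' : A' ∈ G.sets) : A \ A' ∈ G.sets :=
  AlgebraGen.sdiff h h'

theorem r_mem_sets (G : Ultragraph V E) (e : E) : G.r e ∈ G.sets := G.toData.r_mem_alg e

/-- The Boolean algebra of an ultragraph is modelled by itself. -/
def setModel (G : Ultragraph V E) : SetModel G.toData V where
  toSet := id
  injective := Function.injective_id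
  map_empty := rfl
  map_union _ _ := rfl
  map_inter _ _ := rfl
  map_sdiff _ _ := rfl
  vert_ne := by
    rintro _ ⟨v, rfl⟩
    exact Set.singleton_ne_empty v
  vert_inter := by
    rintro _ ⟨v, rfl⟩ A
    by_cases h : v ∈ A
    · exact .inr (Set.inter_eq_self_of_subset_left (Set.singleton_subset_iff.2 h))
    · exact .inl (Set.singleton_inter_eq_empty.2 h)
  r_ne e := (G.r_nonempty e).ne_empty

namespace AdmissiblePair

variable (P : G.AdmissiblePair)

theorem notMem_of_mem_breaking {w : V} (hw : w ∈ G.breaking P.H) : {w} ∉ P.H := by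
  intro h
  obtain ⟨e, he, her⟩ := hw.2.1
  exact her (P.hereditary.range_mem e (by rwa [he]))

theorem singleton_mem {A : Set V} (hA : A ∈ P.H) {v : V} (hv : v ∈ A) : {v} ∈ P.H :=
  P.hereditary.mem_of_subset A hA _ (G.singleton_mem_sets v) (Set.singleton_subset_iff.2 hv)

theorem barSet_of_mem {A : Set V} (hA : A ∈ P.H) : P.barSet A = Sum.inl '' A := by
  ext x
  rcases x with v | w
  · simp [barSet]
  · simp only [barSet, Set.mem_ofPred_eq, Sum.elim_inr, Set.mem_image, reduceCtorEq, and_false,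
      exists_false, iff_false]
    exact fun h => P.notMem_of_mem_breaking w.2.1 (P.singleton_mem hA h)

theorem barSet_singleton {v : V} (hv : v ∉ G.breaking P.H \ P.S) :
    P.barSet {v} = {.inl v} := by
  ext x
  rcases x with u | w
  · simp [barSet]
  · simp only [barSet, Set.mem_ofPred_eq, Sum.elim_inr, Set.mem_singleton_iff, reduceCtorEq,
      iff_false]
    exact fun h => hv (h ▸ w.2)

theorem barSet_singleton_breaking (w : ↥(G.breaking P.H \ P.S)) :
    P.barSet {w.1} = {.inl w.1} ∪ {.inr w} := by
  ext x
  rcases x with u | u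
  · simp [barSet]
  · simp [barSet, Subtype.ext_iff]

theorem barSet_mem {A : Set V} (hA : A ∈ G.sets) : P.barSet A ∈ P.bar.sets := by
  induction hA with
  | basic h =>
    rcases h with ⟨v, rfl⟩ | ⟨e, rfl⟩
    · by_cases hv : v ∈ G.breaking P.H \ P.S
      · change P.barSet {v} ∈ _
        rw [P.barSet_singleton_breaking ⟨v, hv⟩]
        exact .union (P.bar.singleton_mem_sets _) (P.bar.singleton_mem_sets _)
      · change P.barSet {v} ∈ _
        rw [P.barSet_singleton hv]
        exact P.bar.singleton_mem_sets _
    · exact P.bar.toData.r_mem_alg e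
  | empty => exact .empty
  | union _ _ h h' => exact .union h h'
  | inter _ _ h h' => exact .inter h h'
  | sdiff _ _ h h' => exact .sdiff h h'

theorem bar_s {e : E} (he : G.r e ∉ P.H) : P.bar.s e = .inl (G.s e) := by
  simp [bar, he]

theorem inl_preimage_mem {B : Set P.BarVertex} (hB : B ∈ P.bar.sets) :
    Sum.inl ⁻¹' B ∈ G.sets := by
  induction hB with
  | basic h =>
    rcases h with ⟨x, rfl⟩ | ⟨e, rfl⟩
    · rcases x with v | w
      · have : (Sum.inl ⁻¹' {(Sum.inl v : P.BarVertex)} : Set V) = {v} := by ext; simp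
        change (Sum.inl ⁻¹' {(Sum.inl v : P.BarVertex)} : Set V) ∈ _
        rw [this]
        exact G.singleton_mem_sets v
      · have : (Sum.inl ⁻¹' {(Sum.inr w : P.BarVertex)} : Set V) = ∅ := by ext; simp
        change (Sum.inl ⁻¹' {(Sum.inr w : P.BarVertex)} : Set V) ∈ _
        rw [this]
        exact .empty
    · exact G.toData.r_mem_alg e
  | empty => exact .empty
  | union _ _ h h' => exact .union h h'
  | inter _ _ h h' => exact .inter h h'
  | sdiff _ _ h h' => exact .sdiff h h'

/-- A member of the algebra of `𝒢̄` separates `w` from its copy `w'` only for finitely many `w`. -/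
theorem finite_separated {B : Set P.BarVertex} (hB : B ∈ P.bar.sets) :
    {w : ↥(G.breaking P.H \ P.S) | ¬ (Sum.inr w ∈ B ↔ Sum.inl w.1 ∈ B)}.Finite := by
  induction hB with
  | basic h =>
    rcases h with ⟨x, rfl⟩ | ⟨e, rfl⟩
    · rcases x with v | u
      · refine Set.Finite.subset (Set.Finite.preimage Subtype.val_injective.injOn
          (Set.finite_singleton v)) fun w hw => ?_
        simpa using hw
      · refine Set.Finite.subset (Set.finite_singleton u) fun w hw => ?_
        simpa using hw
    · convert Set.finite_empty
      ext w
      simp only [Set.mem_ofPred_eq, Set.mem_empty_iff_false, iff_false, not_not]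
      rfl
  | empty => simp
  | union _ _ h h' =>
    refine (h.union h').subset fun w hw => ?_
    simp only [Set.mem_union, Set.mem_ofPred_eq] at hw ⊢
    tauto
  | inter _ _ h h' =>
    refine (h.union h').subset fun w hw => ?_
    simp only [Set.mem_union, Set.mem_inter_iff, Set.mem_ofPred_eq] at hw ⊢
    tauto
  | sdiff _ _ h h' =>
    refine (h.union h').subset fun w hw => ?_
    simp only [Set.mem_union, Set.mem_sdiff, Set.mem_ofPred_eq] at hw ⊢
    tauto

theorem cls_eq_cls {A A' : Set P.BarVertex} {hA : A ∈ P.bar.sets} {hA' : A' ∈ P.bar.sets} :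
    P.cls A hA = P.cls A' hA' ↔ ∃ W ∈ P.H, A ∪ Sum.inl '' W = A' ∪ Sum.inl '' W :=
  Quotient.eq (r := P.setoid)

theorem cls_eq_empty {A : Set P.BarVertex} {hA : A ∈ P.bar.sets} :
    P.cls A hA = ∅ ↔ ∃ W ∈ P.H, A ⊆ Sum.inl '' W := by
  refine P.cls_eq_cls.trans ?_
  simp only [Set.empty_union, Set.union_eq_right]

theorem cls_barSet_eq_empty {A : Set V} (hA : A ∈ G.sets) :
    P.cls (P.barSet A) (P.barSet_mem hA) = ∅ ↔ A ∈ P.H := by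
  rw [cls_eq_empty]
  constructor
  · rintro ⟨W, hW, h⟩
    refine P.hereditary.mem_of_subset W hW A hA fun v hv => ?_
    obtain ⟨u, hu, huv⟩ := h (show Sum.inl v ∈ P.barSet A from hv)
    rwa [← Sum.inl.inj huv]
  · intro h
    exact ⟨A, h, (P.barSet_of_mem h).subset⟩

theorem vertexClass_inl_eq_empty {v : V} : P.vertexClass (.inl v) = ∅ ↔ {v} ∈ P.H := by
  refine P.cls_eq_empty.trans ⟨?_, fun h => ⟨_, h, by simp⟩⟩
  rintro ⟨W, hW, h⟩
  refine P.singleton_mem hW ?_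
  simpa using h

theorem vertexClass_inr_ne_empty (w : ↥(G.breaking P.H \ P.S)) :
    P.vertexClass (.inr w) ≠ ∅ := by
  intro h
  obtain ⟨W, _, h⟩ := P.cls_eq_empty.1 h
  simp at h

/-- Non-empty classes of different vertices are different. -/
theorem eq_of_vertexClass_eq {x y : P.BarVertex} (h : P.vertexClass x = P.vertexClass y)
    (hx : P.vertexClass x ≠ ∅) : x = y := by
  obtain ⟨W, hW, h⟩ := P.cls_eq_cls.1 h
  have h1 : x ∈ ({y} : Set P.BarVertex) ∪ Sum.inl '' W := h ▸ Or.inl rfl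
  rcases h1 with h1 | h1
  · exact h1
  · exact absurd (P.cls_eq_empty.2 ⟨W, hW, Set.singleton_subset_iff.2 h1⟩) hx

theorem cls_mem_alg {B : Set P.BarVertex} (hB : B ∈ P.bar.sets) :
    P.cls B hB ∈ P.quotient.alg := by
  induction hB with
  | basic h =>
    rcases h with ⟨x, rfl⟩ | ⟨e, rfl⟩
    · change P.vertexClass x ∈ _
      rcases x with v | w
      · by_cases hv : {v} ∈ P.H
        · rw [P.vertexClass_inl_eq_empty.2 hv]
          exact .empty
        · exact P.quotient.vert_mem_alg (.inl ⟨v, hv, rfl⟩)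
      · exact P.quotient.vert_mem_alg (.inr ⟨w, rfl⟩)
    · by_cases he : G.r e ∈ P.H
      · have : P.cls (P.bar.r e) (P.bar.toData.r_mem_alg e) = ∅ :=
          (P.cls_barSet_eq_empty (G.toData.r_mem_alg e)).2 he
        change P.cls (P.bar.r e) (P.bar.toData.r_mem_alg e) ∈ _
        rw [this]
        exact .empty
      · exact P.quotient.r_mem_alg ⟨e, he⟩
  | empty => exact .empty
  | union _ _ h h' => exact .union h h'
  | inter _ _ h h' => exact .inter h h'
  | sdiff _ _ h h' => exact .sdiff h h'

theorem exists_cls (A : P.Class) : ∃ B hB, A = P.cls B hB := by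
  obtain ⟨⟨B, hB⟩, rfl⟩ := Quotient.exists_rep A
  exact ⟨B, hB, rfl⟩

/-- The ultrafilters on the vertices of `𝒢̄` which contain no member of `H`. -/
abbrev Spectrum : Type _ := {U : Ultrafilter P.BarVertex // ∀ W ∈ P.H, Sum.inl '' W ∉ U}

theorem mem_spectrum_congr {A A' : Set P.BarVertex} (U : P.Spectrum)
    (h : ∃ W ∈ P.H, A ∪ Sum.inl '' W = A' ∪ Sum.inl '' W) (hA : A ∈ U.1) : A' ∈ U.1 := by
  obtain ⟨W, hW, h⟩ := h
  have h1 : A' ∪ Sum.inl '' W ∈ U.1 := h ▸ Filter.mem_of_superset hA Set.subset_union_left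
  exact (Ultrafilter.union_mem_iff.1 h1).resolve_right (U.2 W hW)

theorem exists_spectrum {A : Set P.BarVertex} (h : ∀ W ∈ P.H, ¬ A ⊆ Sum.inl '' W) :
    ∃ U : P.Spectrum, A ∈ U.1 := by
  let F : Filter P.BarVertex :=
    { sets := {T | ∃ W ∈ P.H, A ⊆ T ∪ Sum.inl '' W}
      univ_sets := ⟨∅, P.hereditary.empty_mem, by simp⟩
      sets_of_superset := fun ⟨W, hW, h⟩ hT =>
        ⟨W, hW, h.trans (Set.union_subset_union_left _ hT)⟩
      inter_sets := fun {T T'} ⟨W, hW, h⟩ ⟨W', hW', h'⟩ => by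
        refine ⟨W ∪ W', P.hereditary.union_mem W hW W' hW', fun x hx => ?_⟩
        have h1 := h hx
        have h2 := h' hx
        rw [Set.image_union]
        simp only [Set.mem_union, Set.mem_inter_iff] at h1 h2 ⊢
        tauto }
  have hF : F.NeBot := by
    refine Filter.neBot_iff.2 fun h0 => ?_
    obtain ⟨W, hW, h1⟩ : ∅ ∈ F := h0 ▸ Filter.mem_bot
    rw [Set.empty_union] at h1
    exact h W hW h1
  refine ⟨⟨Ultrafilter.of F, fun W hW hmem => ?_⟩, ?_⟩
  · have h1 : (Sum.inl '' W)ᶜ ∈ Ultrafilter.of F :=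
      Ultrafilter.of_le F ⟨W, hW, by rw [Set.compl_union_self]; exact Set.subset_univ A⟩
    exact Ultrafilter.compl_notMem_iff.2 hmem h1
  · exact Ultrafilter.of_le F ⟨∅, P.hereditary.empty_mem, Set.subset_union_left⟩

/-- The Stone representation of the Boolean algebra of a quotient ultragraph. -/
def quotientModel : SetModel P.quotient P.Spectrum where
  toSet := Quotient.lift (fun A => {U | A.1 ∈ U.1}) fun _ _ h => Set.ext fun U =>
    ⟨P.mem_spectrum_congr U h, P.mem_spectrum_congr U (P.setoid.symm h)⟩
  injective := by
    have key : ∀ B B' : Set P.BarVertex,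
        {U : P.Spectrum | B ∈ U.1} = {U | B' ∈ U.1} → ∃ W ∈ P.H, B \ B' ⊆ Sum.inl '' W := by
      intro B B' h
      by_contra! hc
      obtain ⟨U, hU⟩ := P.exists_spectrum hc
      have h1 : B ∈ U.1 := Filter.mem_of_superset hU Set.sdiff_subset
      have h2 : B' ∈ U.1 := h.subset h1
      have h3 := Filter.inter_mem hU h2
      rw [Set.sdiff_inter_self] at h3
      exact Ultrafilter.empty_notMem h3
    intro A A' h
    obtain ⟨B, hB, rfl⟩ := P.exists_cls A
    obtain ⟨B', hB', rfl⟩ := P.exists_cls A'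
    obtain ⟨W, hW, h1⟩ := key B B' h
    obtain ⟨W', hW', h2⟩ := key B' B h.symm
    refine P.cls_eq_cls.2 ⟨W ∪ W', P.hereditary.union_mem W hW W' hW', ?_⟩
    ext x
    have h3 := @h1 x
    have h4 := @h2 x
    rw [Set.image_union]
    simp only [Set.mem_union, Set.mem_sdiff] at h3 h4 ⊢
    tauto
  map_empty := Set.eq_empty_of_forall_notMem fun U h => Ultrafilter.empty_notMem h
  map_union A A' := by
    obtain ⟨B, hB, rfl⟩ := P.exists_cls A
    obtain ⟨B', hB', rfl⟩ := P.exists_cls A'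
    exact Set.ext fun U => Ultrafilter.union_mem_iff
  map_inter A A' := by
    obtain ⟨B, hB, rfl⟩ := P.exists_cls A
    obtain ⟨B', hB', rfl⟩ := P.exists_cls A'
    exact Set.ext fun U => Filter.inter_mem_iff
  map_sdiff A A' := by
    obtain ⟨B, hB, rfl⟩ := P.exists_cls A
    obtain ⟨B', hB', rfl⟩ := P.exists_cls A'
    exact Set.ext fun U => Ultrafilter.sdiff_mem_iff U.1
  vert_ne := by
    rintro _ (⟨v, hv, rfl⟩ | ⟨w, rfl⟩)
    · exact fun h => hv (P.vertexClass_inl_eq_empty.1 h)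
    · exact P.vertexClass_inr_ne_empty w
  vert_inter := by
    have key : ∀ (x : P.BarVertex) (A : P.Class),
        P.vertexClass x ∩ A = ∅ ∨ P.vertexClass x ∩ A = P.vertexClass x := by
      intro x A
      obtain ⟨B, hB, rfl⟩ := P.exists_cls A
      by_cases h : x ∈ B
      · exact .inr (P.cls_eq_cls.2 ⟨∅, P.hereditary.empty_mem, by
          rw [Set.inter_eq_self_of_subset_left (Set.singleton_subset_iff.2 h)]⟩)
      · exact .inl (P.cls_eq_cls.2 ⟨∅, P.hereditary.empty_mem, by
          rw [Set.singleton_inter_eq_empty.2 h]⟩)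
    rintro _ (⟨v, hv, rfl⟩ | ⟨w, rfl⟩) A
    exacts [key _ A, key _ A]
  r_ne e h := e.2 ((P.cls_barSet_eq_empty (G.toData.r_mem_alg e.1)).1 h)

end AdmissiblePair

end Ultragraph

/-! ### The homomorphism onto the algebra of the quotient ultragraph -/

namespace Ultragraph

open UltragraphData

variable {V E : Type*} {G : Ultragraph V E}

namespace AdmissiblePair

variable (P : G.AdmissiblePair) (R : Type*) [CommRing R]

/-- The idempotent `q_[B]`. -/
def q (B : Set P.BarVertex) (hB : B ∈ P.bar.sets) : P.quotient.LeavittAlgebra R :=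
  LeavittAlgebra.p P.quotient R ⟨P.cls B hB, P.cls_mem_alg hB⟩

open Classical in
/-- The element `t_e`, which is zero if `e` is not an edge of the quotient ultragraph. -/
def qt (e : E) : P.quotient.LeavittAlgebra R :=
  if h : G.r e ∉ P.H then LeavittAlgebra.t P.quotient R ⟨e, h⟩ else 0

open Classical in
/-- The element `t_{e^*}`, which is zero if `e` is not an edge of the quotient ultragraph. -/
def qtStar (e : E) : P.quotient.LeavittAlgebra R :=
  if h : G.r e ∉ P.H then LeavittAlgebra.tStar P.quotient R ⟨e, h⟩ else 0

variable {R}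

theorem qt_of_notMem {e : E} (h : G.r e ∉ P.H) :
    P.qt R e = LeavittAlgebra.t P.quotient R ⟨e, h⟩ := dif_pos h

theorem qtStar_of_notMem {e : E} (h : G.r e ∉ P.H) :
    P.qtStar R e = LeavittAlgebra.tStar P.quotient R ⟨e, h⟩ := dif_pos h

theorem qt_of_mem {e : E} (h : G.r e ∈ P.H) : P.qt R e = 0 := dif_neg (not_not.2 h)

theorem qtStar_of_mem {e : E} (h : G.r e ∈ P.H) : P.qtStar R e = 0 := dif_neg (not_not.2 h)

theorem q_eq_zero {B : Set P.BarVertex} (hB : B ∈ P.bar.sets) (h : P.cls B hB = ∅) :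
    P.q R B hB = 0 := by
  unfold q
  simp only [h]
  exact LeavittAlgebra.p_empty

theorem q_mul_q {B B' : Set P.BarVertex} (hB : B ∈ P.bar.sets) (hB' : B' ∈ P.bar.sets) :
    P.q R B hB * P.q R B' hB' = P.q R (B ∩ B') (inter_mem_sets hB hB') :=
  LeavittAlgebra.p_mul_p _ _

theorem q_union {B B' : Set P.BarVertex} (hB : B ∈ P.bar.sets) (hB' : B' ∈ P.bar.sets) :
    P.q R (B ∪ B') (union_mem_sets hB hB') =
      P.q R B hB + P.q R B' hB' - P.q R (B ∩ B') (inter_mem_sets hB hB') :=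
  LeavittAlgebra.p_union ⟨P.cls B hB, P.cls_mem_alg hB⟩ ⟨P.cls B' hB', P.cls_mem_alg hB'⟩

theorem q_congr {B B' : Set P.BarVertex} (h : B = B') (hB : B ∈ P.bar.sets)
    (hB' : B' ∈ P.bar.sets) : P.q R B hB = P.q R B' hB' := by
  subst h
  rfl

variable (R) in
/-- The idempotent of a vertex of `𝒢̄`. -/
abbrev qv (x : P.BarVertex) : P.quotient.LeavittAlgebra R :=
  P.q R {x} (P.bar.singleton_mem_sets x)

theorem q_mul_qv {B : Set P.BarVertex} (hB : B ∈ P.bar.sets) {x : P.BarVertex} (hx : x ∈ B) :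
    P.q R B hB * P.qv R x = P.qv R x := by
  rw [q_mul_q]
  exact P.q_congr (Set.inter_eq_self_of_subset_right (Set.singleton_subset_iff.2 hx)) _ _

theorem qv_mul_q {B : Set P.BarVertex} (hB : B ∈ P.bar.sets) {x : P.BarVertex} (hx : x ∈ B) :
    P.qv R x * P.q R B hB = P.qv R x := by
  rw [q_mul_q]
  exact P.q_congr (Set.inter_eq_self_of_subset_left (Set.singleton_subset_iff.2 hx)) _ _

theorem qv_mul_qt (e : E) : P.qv R (.inl (G.s e)) * P.qt R e = P.qt R e := by
  by_cases h : G.r e ∈ P.H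
  · rw [P.qt_of_mem h, mul_zero]
  · rw [P.qt_of_notMem h]
    have := LeavittAlgebra.p_s_mul_t (D := P.quotient) (R := R) ⟨e, h⟩
    have h0 : P.qv R (.inl (G.s e)) = P.qv R (P.bar.s e) := P.q_congr (by rw [P.bar_s h]) _ _
    rw [h0]
    exact this

theorem qtStar_mul_qv (e : E) : P.qtStar R e * P.qv R (.inl (G.s e)) = P.qtStar R e := by
  by_cases h : G.r e ∈ P.H
  · rw [P.qtStar_of_mem h, zero_mul]
  · rw [P.qtStar_of_notMem h]
    have := LeavittAlgebra.tStar_mul_p_s (D := P.quotient) (R := R) ⟨e, h⟩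
    have h0 : P.qv R (.inl (G.s e)) = P.qv R (P.bar.s e) := P.q_congr (by rw [P.bar_s h]) _ _
    rw [h0]
    exact this

theorem quotient_s_eq_iff {v : V} (hv : {v} ∉ P.H) (e : {e : E // G.r e ∉ P.H}) :
    P.quotient.s e = P.vertexClass (.inl v) ↔ G.s e.1 = v := by
  change P.vertexClass (P.bar.s e.1) = _ ↔ _
  rw [P.bar_s e.2]
  constructor
  · intro h
    exact (Sum.inl.inj (P.eq_of_vertexClass_eq h.symm
      fun h' => hv (P.vertexClass_inl_eq_empty.1 h'))).symm
  · rintro rfl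
    rfl

/-- The relation (LP4) in the quotient ultragraph. It applies to breaking vertices too. -/
theorem qv_eq_sum {v : V} (hv : {v} ∉ P.H) (hne : {e | G.s e = v ∧ G.r e ∉ P.H}.Nonempty)
    (hfin : {e | G.s e = v ∧ G.r e ∉ P.H}.Finite) :
    P.qv R (.inl v) = ∑ e ∈ hfin.toFinset, P.qt R e * P.qtStar R e := by
  have hset : {e | P.quotient.s e = P.vertexClass (.inl v)} =
      Subtype.val ⁻¹' {e | G.s e = v ∧ G.r e ∉ P.H} := by
    ext e
    exact (P.quotient_s_eq_iff hv e).trans ⟨fun h => ⟨h, e.2⟩, fun h => h.1⟩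
  have hfin' : {e | P.quotient.s e = P.vertexClass (.inl v)}.Finite := by
    rw [hset]
    exact hfin.preimage Subtype.val_injective.injOn
  have hne' : {e | P.quotient.s e = P.vertexClass (.inl v)}.Nonempty := by
    obtain ⟨e, he⟩ := hne
    rw [hset]
    exact ⟨⟨e, he.2⟩, he⟩
  refine (LeavittAlgebra.p_vert (R := R) _ (Or.inl ⟨v, hv, rfl⟩) hne' hfin').trans ?_
  refine Finset.sum_of_injOn Subtype.val Subtype.val_injective.injOn ?_ ?_ ?_
  · intro e he
    have he' := hset.subset (hfin'.mem_toFinset.1 he)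
    exact hfin.mem_toFinset.2 he'
  · intro e he hne
    have he' := hfin.mem_toFinset.1 he
    exact absurd ⟨⟨e, he'.2⟩, hfin'.mem_toFinset.2 (hset.symm.subset he'), rfl⟩ hne
  · intro e _
    rw [P.qt_of_notMem e.2, P.qtStar_of_notMem e.2]

variable (R) in
/-- The images of the generators of `L_R(𝒢)` in the algebra of the quotient ultragraph. -/
def toQuotientFamily : LeavittFamily G.toData (P.quotient.LeavittAlgebra R) where
  p A hA := P.q R (P.barSet A) (P.barSet_mem hA)
  t := P.qt R
  tStar := P.qtStar R
  p_empty := P.q_eq_zero _ rfl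
  p_inter A A' h h' := P.q_mul_q _ _
  p_union A A' h h' := P.q_union (P.barSet_mem h) (P.barSet_mem h')
  p_s_mul_t e := by
    rw [← P.qv_mul_qt, ← mul_assoc, P.q_mul_qv]
    exact Set.mem_singleton (G.s e)
  t_mul_p_r e := by
    by_cases h : G.r e ∈ P.H
    · rw [P.qt_of_mem h, zero_mul]
    · rw [P.qt_of_notMem h]
      exact LeavittAlgebra.t_mul_p_r (D := P.quotient) (R := R) ⟨e, h⟩
  p_r_mul_tStar e := by
    by_cases h : G.r e ∈ P.H
    · rw [P.qtStar_of_mem h, mul_zero]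
    · rw [P.qtStar_of_notMem h]
      exact LeavittAlgebra.p_r_mul_tStar (D := P.quotient) (R := R) ⟨e, h⟩
  tStar_mul_p_s e := by
    rw [← P.qtStar_mul_qv, mul_assoc, P.qv_mul_q]
    exact Set.mem_singleton (G.s e)
  tStar_mul_t e := by
    by_cases h : G.r e ∈ P.H
    · rw [P.qtStar_of_mem h, zero_mul, P.q_eq_zero]
      exact (P.cls_barSet_eq_empty (G.toData.r_mem_alg e)).2 h
    · rw [P.qt_of_notMem h, P.qtStar_of_notMem h]
      exact LeavittAlgebra.tStar_mul_t (D := P.quotient) (R := R) ⟨e, h⟩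
  tStar_mul_t_of_ne e f hef := by
    by_cases h : G.r e ∈ P.H
    · rw [P.qtStar_of_mem h, zero_mul]
    by_cases h' : G.r f ∈ P.H
    · rw [P.qt_of_mem h', mul_zero]
    rw [P.qtStar_of_notMem h, P.qt_of_notMem h']
    exact LeavittAlgebra.tStar_mul_t_of_ne fun h => hef (congrArg Subtype.val h)
  p_vert := by
    rintro _ ⟨v, rfl⟩ hne hfin
    have hset : {e | G.toData.s e = {v}} = {e | G.s e = v} :=
      Set.ext fun e => Set.singleton_eq_singleton_iff
    by_cases hv : {v} ∈ P.H
    · rw [P.q_eq_zero _ ((P.cls_barSet_eq_empty (G.singleton_mem_sets v)).2 hv)]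
      refine (Finset.sum_eq_zero fun e he => ?_).symm
      have he' : G.s e = v := hset.subset (hfin.mem_toFinset.1 he)
      rw [P.qt_of_mem (P.hereditary.range_mem e (he' ▸ hv)), zero_mul]
    · have hfinv : {e | G.s e = v}.Finite := hset ▸ hfin
      have hsub : {e | G.s e = v ∧ G.r e ∉ P.H} ⊆ {e | G.s e = v} := fun e he => he.1
      have hne' : {e | G.s e = v ∧ G.r e ∉ P.H}.Nonempty := by
        by_contra hemp
        rw [Set.not_nonempty_iff_eq_empty] at hemp
        refine hv (P.saturated v (hset ▸ hne) hfinv fun e he => ?_)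
        by_contra her
        exact hemp.subset (show e ∈ {e | G.s e = v ∧ G.r e ∉ P.H} from ⟨he, her⟩)
      have h1 := P.barSet_singleton (v := v) fun h => h.1.1 hfinv
      refine (P.q_congr h1 _ (P.bar.singleton_mem_sets _)).trans
        ((P.qv_eq_sum hv hne' (hfinv.subset hsub)).trans ?_)
      refine Finset.sum_subset (fun e he => ?_) fun e _ he => ?_
      · simp only [Set.Finite.mem_toFinset] at he ⊢
        exact hset.symm.subset he.1
      · simp only [Set.Finite.mem_toFinset, Set.mem_ofPred_eq, not_and, not_not] at he
        have hs : G.s e = v := hset.subset (by simpa using ‹e ∈ hfin.toFinset›)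
        rw [P.qt_of_mem (he hs), zero_mul]

variable (R) in
/-- The homomorphism from `L_R(𝒢)` to the algebra of the quotient ultragraph. -/
def toQuotient : G.LeavittPathAlgebra R →ₙₐ[R] P.quotient.LeavittAlgebra R :=
  (P.toQuotientFamily R).lift R

theorem toQuotient_p (A : G.sets) :
    P.toQuotient R (G.p R A) = P.q R (P.barSet A.1) (P.barSet_mem A.2) :=
  LeavittFamily.lift_p _ _

theorem toQuotient_t (e : E) : P.toQuotient R (G.t R e) = P.qt R e :=
  LeavittFamily.lift_t _ _

theorem toQuotient_tStar (e : E) : P.toQuotient R (G.tStar R e) = P.qtStar R e :=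
  LeavittFamily.lift_tStar _ _

theorem toQuotient_gap (w : G.breaking P.H) :
    P.toQuotient R (G.gap R P.H w) =
      P.q R (P.barSet {w.1}) (P.barSet_mem (G.singleton_mem_sets _)) - P.qv R (.inl w.1) := by
  rw [gap, map_sub, toQuotient_p, P.qv_eq_sum (P.notMem_of_mem_breaking w.2) w.2.2.1 w.2.2.2,
    map_sum]
  simp only [map_mul, toQuotient_t, toQuotient_tStar]

theorem toQuotient_gap_of_mem (w : G.breaking P.H) (hw : w.1 ∈ P.S) :
    P.toQuotient R (G.gap R P.H w) = 0 := by
  rw [toQuotient_gap, sub_eq_zero]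
  exact P.q_congr (P.barSet_singleton fun h => h.2 hw) _ _

theorem toQuotient_gap_of_notMem (w : ↥(G.breaking P.H \ P.S)) :
    P.toQuotient R (G.gap R P.H ⟨w.1, w.2.1⟩) = P.qv R (.inr w) := by
  have h1 : P.q R (B := {.inl w.1} ∩ {.inr w})
      (inter_mem_sets (P.bar.singleton_mem_sets _) (P.bar.singleton_mem_sets _)) = 0 :=
    P.q_eq_zero _ (P.cls_eq_empty.2 ⟨∅, P.hereditary.empty_mem, by simp⟩)
  have h2 := P.q_union (R := R) (P.bar.singleton_mem_sets (.inl w.1))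
    (P.bar.singleton_mem_sets (.inr w))
  rw [h1, sub_zero] at h2
  rw [toQuotient_gap, sub_eq_iff_eq_add']
  exact (P.q_congr (P.barSet_singleton_breaking w) _ _).trans h2

theorem toQuotient_eq_zero_of_mem {x : G.LeavittPathAlgebra R} (hx : x ∈ G.idealOf R P) :
    P.toQuotient R x = 0 := by
  refine (TwoSidedIdeal.mem_ker (P.toQuotient R)).1 ?_
  refine TwoSidedIdeal.mem_span_iff.1 hx _ ?_
  rintro _ (⟨A, hA, rfl⟩ | ⟨w, hw, rfl⟩)
  · refine (TwoSidedIdeal.mem_ker (P.toQuotient R)).2 ?_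
    rw [toQuotient_p]
    exact P.q_eq_zero _ ((P.cls_barSet_eq_empty A.2).2 hA)
  · exact (TwoSidedIdeal.mem_ker (P.toQuotient R)).2 (P.toQuotient_gap_of_mem w hw)

theorem toQuotient_surjective : Function.Surjective (P.toQuotient R) := by
  have hp : ∀ B hB, ∃ x, P.toQuotient R x = P.q R B hB := by
    intro B hB
    induction hB with
    | basic h =>
      rcases h with ⟨x, rfl⟩ | ⟨e, rfl⟩
      · change ∃ y, P.toQuotient R y = P.qv R x
        rcases x with v | w
        · by_cases hv : v ∈ G.breaking P.H \ P.S
          · refine ⟨∑ e ∈ hv.1.2.2.toFinset, G.t R e * G.tStar R e, ?_⟩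
            rw [P.qv_eq_sum (P.notMem_of_mem_breaking hv.1) hv.1.2.1 hv.1.2.2, map_sum]
            simp only [map_mul, toQuotient_t, toQuotient_tStar]
          · refine ⟨G.p R ⟨{v}, G.singleton_mem_sets v⟩, ?_⟩
            rw [toQuotient_p]
            exact P.q_congr (P.barSet_singleton hv) _ _
        · exact ⟨_, P.toQuotient_gap_of_notMem w⟩
      · exact ⟨G.p R ⟨_, G.toData.r_mem_alg e⟩, P.toQuotient_p _⟩
    | empty => exact ⟨0, (map_zero _).trans (P.q_eq_zero _ rfl).symm⟩
    | @union B B' hB hB' h h' =>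
      obtain ⟨x, hx⟩ := h
      obtain ⟨y, hy⟩ := h'
      refine ⟨x + y - x * y, ?_⟩
      rw [map_sub, map_add, map_mul, hx, hy]
      exact (congrArg _ (P.q_mul_q hB hB')).trans (P.q_union hB hB').symm
    | @inter B B' hB hB' h h' =>
      obtain ⟨x, hx⟩ := h
      obtain ⟨y, hy⟩ := h'
      refine ⟨x * y, ?_⟩
      rw [map_mul, hx, hy]
      exact P.q_mul_q hB hB'
    | @sdiff B B' hB hB' h h' =>
      obtain ⟨x, hx⟩ := h
      obtain ⟨y, hy⟩ := h'
      refine ⟨x - x * y, ?_⟩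
      have h1 : P.q R (B ∩ B') (inter_mem_sets hB hB') + P.q R (B \ B') (sdiff_mem_sets hB hB') =
          P.q R B hB :=
        P.quotientModel.p_inter_add_p_sdiff (R := R) ⟨P.cls B hB, P.cls_mem_alg hB⟩
          ⟨P.cls B' hB', P.cls_mem_alg hB'⟩
      rw [map_sub, map_mul, hx, hy]
      exact sub_eq_iff_eq_add'.2 ((congrArg (· + _) (P.q_mul_q hB hB')).trans h1).symm
  intro y
  induction y using LeavittAlgebra.induction with
  | hp A =>
    obtain ⟨A, hA⟩ := A
    obtain ⟨B, hB, rfl⟩ := P.exists_cls A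
    exact hp B hB
  | ht e => exact ⟨G.t R e.1, by rw [toQuotient_t, P.qt_of_notMem e.2]⟩
  | hts e => exact ⟨G.tStar R e.1, by rw [toQuotient_tStar, P.qtStar_of_notMem e.2]⟩
  | zero => exact ⟨0, map_zero _⟩
  | add x y hx hy =>
    obtain ⟨x, rfl⟩ := hx
    obtain ⟨y, rfl⟩ := hy
    exact ⟨x + y, map_add _ _ _⟩
  | smul c x hx =>
    obtain ⟨x, rfl⟩ := hx
    exact ⟨c • x, map_smul _ _ _⟩
  | mul x y hx hy =>
    obtain ⟨x, rfl⟩ := hx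
    obtain ⟨y, rfl⟩ := hy
    exact ⟨x * y, map_mul _ _ _⟩

end AdmissiblePair

end Ultragraph

/-! ### The inverse homomorphism -/

namespace Ultragraph

open UltragraphData

variable {V E : Type*} {G : Ultragraph V E} {R : Type*} [CommRing R]

theorem p_mul_p (A A' : G.sets) :
    G.p R A * G.p R A' = G.p R ⟨A.1 ∩ A'.1, inter_mem_sets A.2 A'.2⟩ :=
  LeavittAlgebra.p_mul_p A A'

theorem p_union (A A' : G.sets) :
    G.p R ⟨A.1 ∪ A'.1, union_mem_sets A.2 A'.2⟩ =
      G.p R A + G.p R A' - G.p R ⟨A.1 ∩ A'.1, inter_mem_sets A.2 A'.2⟩ :=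
  LeavittAlgebra.p_union A A'

theorem p_congr {A A' : Set V} (h : A = A') (hA : A ∈ G.sets) (hA' : A' ∈ G.sets) :
    G.p R ⟨A, hA⟩ = G.p R ⟨A', hA'⟩ := by
  subst h
  rfl

variable (G R) in
/-- The idempotent `p_v`. -/
def pv (v : V) : G.LeavittPathAlgebra R := G.p R ⟨{v}, G.singleton_mem_sets v⟩

variable (G R) in
theorem p_empty : G.p R ⟨∅, .empty⟩ = 0 := LeavittAlgebra.p_empty

open Classical in
theorem p_mul_pv (A : G.sets) (v : V) :
    G.p R A * G.pv R v = if v ∈ A.1 then G.pv R v else 0 := by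
  refine (p_mul_p _ _).trans ?_
  split_ifs with h
  · exact p_congr (Set.inter_eq_self_of_subset_right (Set.singleton_subset_iff.2 h)) _ _
  · exact (p_congr (Set.inter_singleton_eq_empty.2 h) _ _).trans (p_empty G R)

open Classical in
theorem pv_mul_p (A : G.sets) (v : V) :
    G.pv R v * G.p R A = if v ∈ A.1 then G.pv R v else 0 := by
  refine (G.setModel.p_mul_p_comm _ A).trans ?_
  exact p_mul_pv A v

variable (G R) in
theorem pv_mul_t (e : E) : G.pv R (G.s e) * G.t R e = G.t R e := LeavittAlgebra.p_s_mul_t e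

variable (G R) in
theorem t_mul_p_r (e : E) : G.t R e * G.p R ⟨G.r e, G.r_mem_sets e⟩ = G.t R e :=
  LeavittAlgebra.t_mul_p_r e

variable (G R) in
theorem p_r_mul_tStar (e : E) : G.p R ⟨G.r e, G.r_mem_sets e⟩ * G.tStar R e = G.tStar R e :=
  LeavittAlgebra.p_r_mul_tStar e

variable (G R) in
theorem tStar_mul_pv (e : E) : G.tStar R e * G.pv R (G.s e) = G.tStar R e :=
  LeavittAlgebra.tStar_mul_p_s e

variable (G R) in
theorem tStar_mul_t (e : E) : G.tStar R e * G.t R e = G.p R ⟨G.r e, G.r_mem_sets e⟩ :=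
  LeavittAlgebra.tStar_mul_t e

variable (G R) in
theorem tStar_mul_t_of_ne {e f : E} (h : e ≠ f) : G.tStar R e * G.t R f = 0 :=
  LeavittAlgebra.tStar_mul_t_of_ne h

variable (G R) in
theorem pv_eq_sum (v : V) (hne : {e | G.s e = v}.Nonempty) (hfin : {e | G.s e = v}.Finite) :
    G.pv R v = ∑ e ∈ hfin.toFinset, G.t R e * G.tStar R e := by
  have hset : {e | G.toData.s e = {v}} = {e | G.s e = v} :=
    Set.ext fun e => Set.singleton_eq_singleton_iff
  refine (LeavittAlgebra.p_vert (D := G.toData) _ ⟨v, rfl⟩ (hset ▸ hne) (hset ▸ hfin)).trans ?_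
  refine Finset.sum_congr ?_ fun _ _ => rfl
  ext e
  simp only [Set.Finite.mem_toFinset]
  exact Set.ext_iff.1 hset e

open Classical in
theorem p_mul_t (A : G.sets) (e : E) :
    G.p R A * G.t R e = if G.s e ∈ A.1 then G.t R e else 0 := by
  rw [← pv_mul_t, ← mul_assoc, p_mul_pv]
  split_ifs
  exacts [rfl, zero_mul _]

open Classical in
theorem tStar_mul_p (A : G.sets) (e : E) :
    G.tStar R e * G.p R A = if G.s e ∈ A.1 then G.tStar R e else 0 := by
  rw [← tStar_mul_pv, mul_assoc, pv_mul_p]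
  split_ifs
  exacts [rfl, mul_zero _]

theorem gap_eq (H : Set (Set V)) (w : G.breaking H) :
    G.gap R H w = G.pv R w.1 - ∑ e ∈ w.2.2.2.toFinset, G.t R e * G.tStar R e := rfl

theorem pv_mul_pv_self (v : V) : G.pv R v * G.pv R v = G.pv R v :=
  (p_mul_pv ⟨{v}, G.singleton_mem_sets v⟩ v).trans (if_pos (Set.mem_singleton v))

theorem pv_mul_pv_of_ne {v w : V} (h : w ≠ v) : G.pv R v * G.pv R w = 0 :=
  (p_mul_pv ⟨{v}, G.singleton_mem_sets v⟩ w).trans (if_neg h)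

theorem pv_mul_gap (H : Set (Set V)) (w : G.breaking H) :
    G.pv R w.1 * G.gap R H w = G.gap R H w := by
  rw [gap_eq, mul_sub, pv_mul_pv_self, Finset.mul_sum]
  congr 1
  refine Finset.sum_congr rfl fun e he => ?_
  have hs : G.s e = w.1 := (w.2.2.2.mem_toFinset.1 he).1
  rw [← mul_assoc, ← hs, pv_mul_t]

theorem gap_mul_pv (H : Set (Set V)) (w : G.breaking H) :
    G.gap R H w * G.pv R w.1 = G.gap R H w := by
  rw [gap_eq, sub_mul, pv_mul_pv_self, Finset.sum_mul]
  congr 1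
  refine Finset.sum_congr rfl fun e he => ?_
  have hs : G.s e = w.1 := (w.2.2.2.mem_toFinset.1 he).1
  rw [mul_assoc, ← hs, tStar_mul_pv]

open Classical in
theorem p_mul_gap (H : Set (Set V)) (w : G.breaking H) (A : G.sets) :
    G.p R A * G.gap R H w = if w.1 ∈ A.1 then G.gap R H w else 0 := by
  rw [← pv_mul_gap, ← mul_assoc, p_mul_pv]
  split_ifs
  exacts [rfl, zero_mul _]

open Classical in
theorem gap_mul_p (H : Set (Set V)) (w : G.breaking H) (A : G.sets) :
    G.gap R H w * G.p R A = if w.1 ∈ A.1 then G.gap R H w else 0 := by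
  rw [← gap_mul_pv, mul_assoc, pv_mul_p]
  split_ifs
  exacts [rfl, mul_zero _]

theorem tStar_mul_gap (H : Set (Set V)) (w : G.breaking H) {e : E} (he : G.r e ∉ H) :
    G.tStar R e * G.gap R H w = 0 := by
  by_cases hs : G.s e = w.1
  · have h0 : G.tStar R e * G.pv R w.1 = G.tStar R e := by rw [← hs, tStar_mul_pv]
    rw [gap_eq, mul_sub, h0, Finset.mul_sum, Finset.sum_eq_single_of_mem e
      (w.2.2.2.mem_toFinset.2 ⟨hs, he⟩), ← mul_assoc, tStar_mul_t, p_r_mul_tStar, sub_self]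
    intro f _ hf
    rw [← mul_assoc, tStar_mul_t_of_ne G R hf.symm, zero_mul]
  · rw [← pv_mul_gap, ← tStar_mul_pv, mul_assoc, ← mul_assoc (G.pv R _),
      pv_mul_pv_of_ne (Ne.symm hs), zero_mul, mul_zero]

theorem gap_mul_t (H : Set (Set V)) (w : G.breaking H) {e : E} (he : G.r e ∉ H) :
    G.gap R H w * G.t R e = 0 := by
  by_cases hs : G.s e = w.1
  · have h0 : G.pv R w.1 * G.t R e = G.t R e := by rw [← hs, pv_mul_t]
    rw [gap_eq, sub_mul, h0, Finset.sum_mul, Finset.sum_eq_single_of_mem e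
      (w.2.2.2.mem_toFinset.2 ⟨hs, he⟩), mul_assoc, tStar_mul_t, t_mul_p_r, sub_self]
    intro f _ hf
    rw [mul_assoc, tStar_mul_t_of_ne G R hf, mul_zero]
  · rw [← gap_mul_pv, ← pv_mul_t, mul_assoc, ← mul_assoc (G.pv R _) (G.pv R _),
      pv_mul_pv_of_ne hs, zero_mul, mul_zero]

theorem gap_mul_gap_self (H : Set (Set V)) (w : G.breaking H) :
    G.gap R H w * G.gap R H w = G.gap R H w := by
  nth_rw 1 [gap_eq]
  rw [sub_mul, pv_mul_gap, Finset.sum_mul, Finset.sum_eq_zero, sub_zero]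
  intro e he
  rw [mul_assoc, tStar_mul_gap H w (w.2.2.2.mem_toFinset.1 he).2, mul_zero]

theorem gap_mul_gap_of_ne (H : Set (Set V)) {w w' : G.breaking H} (h : w.1 ≠ w'.1) :
    G.gap R H w * G.gap R H w' = 0 := by
  rw [← gap_mul_pv, ← pv_mul_gap H w', mul_assoc, ← mul_assoc (G.pv R _) (G.pv R _),
    pv_mul_pv_of_ne h.symm, zero_mul, mul_zero]

namespace AdmissiblePair

variable (P : G.AdmissiblePair)

variable (R) in
/-- The gap idempotent of a breaking vertex `w` outside `S`, which corresponds to the vertex `w'`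
of the quotient ultragraph. -/
def outerGap (w : ↥(G.breaking P.H \ P.S)) : G.LeavittPathAlgebra R :=
  G.gap R P.H ⟨w.1, w.2.1⟩

open Classical in
theorem outerGap_mul_outerGap (w w' : ↥(G.breaking P.H \ P.S)) :
    P.outerGap R w * P.outerGap R w' = if w = w' then P.outerGap R w else 0 := by
  split_ifs with h
  · subst h
    exact gap_mul_gap_self _ _
  · exact gap_mul_gap_of_ne _ fun h' => h (Subtype.ext h')

open Classical in
/-- The difference of the indicator functions of `B` at `w'` and at `w`. -/
def coef (B : Set P.BarVertex) (w : ↥(G.breaking P.H \ P.S)) : ℤ :=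
  (if Sum.inr w ∈ B then 1 else 0) - if Sum.inl w.1 ∈ B then 1 else 0

theorem coef_eq_zero {B : Set P.BarVertex} {w : ↥(G.breaking P.H \ P.S)}
    (h : Sum.inr w ∈ B ↔ Sum.inl w.1 ∈ B) : P.coef B w = 0 := by
  unfold coef
  split_ifs with h1 h2 h2
  exacts [sub_self 1, absurd (h.1 h1) h2, absurd (h.2 h2) h1, sub_self 0]

variable (R) in
/-- The element of `L_R(𝒢)` which corresponds to a set `B` of vertices of `𝒢̄`: the idempotent of
`B ∩ G⁰`, corrected by the gap idempotents of the finitely many `w` at which `B` contains only one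
of `w` and `w'`. -/
def barRep (B : Set P.BarVertex) (hB : B ∈ P.bar.sets) : G.LeavittPathAlgebra R :=
  G.p R ⟨Sum.inl ⁻¹' B, P.inl_preimage_mem hB⟩ +
    ∑ w ∈ (P.finite_separated hB).toFinset, P.coef B w • P.outerGap R w

theorem barRep_eq {B : Set P.BarVertex} (hB : B ∈ P.bar.sets)
    {F : Finset ↥(G.breaking P.H \ P.S)}
    (hF : {w : ↥(G.breaking P.H \ P.S) | ¬ (Sum.inr w ∈ B ↔ Sum.inl w.1 ∈ B)} ⊆ F) :
    P.barRep R B hB = G.p R ⟨Sum.inl ⁻¹' B, P.inl_preimage_mem hB⟩ +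
      ∑ w ∈ F, P.coef B w • P.outerGap R w := by
  rw [barRep]
  congr 1
  refine Finset.sum_subset (fun w hw => hF ((P.finite_separated hB).mem_toFinset.1 hw)) ?_
  intro w _ hw
  rw [Set.Finite.mem_toFinset, Set.mem_ofPred_eq, not_not] at hw
  rw [P.coef_eq_zero hw, zero_smul]

theorem barRep_of_forall {B : Set P.BarVertex} (hB : B ∈ P.bar.sets)
    (h : ∀ w : ↥(G.breaking P.H \ P.S), Sum.inr w ∈ B ↔ Sum.inl w.1 ∈ B) :
    P.barRep R B hB = G.p R ⟨Sum.inl ⁻¹' B, P.inl_preimage_mem hB⟩ := by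
  rw [P.barRep_eq hB (F := ∅) fun w hw => (hw (h w)).elim, Finset.sum_empty, add_zero]

theorem barRep_barSet (A : G.sets) :
    P.barRep R (P.barSet A.1) (P.barSet_mem A.2) = G.p R A :=
  P.barRep_of_forall _ fun _ => Iff.rfl

theorem barRep_mul {B B' : Set P.BarVertex} (hB : B ∈ P.bar.sets) (hB' : B' ∈ P.bar.sets) :
    P.barRep R B hB * P.barRep R B' hB' = P.barRep R (B ∩ B') (inter_mem_sets hB hB') := by
  classical
  let F := (P.finite_separated hB).toFinset ∪ (P.finite_separated hB').toFinset
  rw [P.barRep_eq hB (F := F) (fun w hw => by simpa [F] using Or.inl hw),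
    P.barRep_eq hB' (F := F) (fun w hw => by simpa [F] using Or.inr hw),
    P.barRep_eq _ (F := F) (fun w hw => by
      simp only [Set.mem_inter_iff, Set.mem_ofPred_eq] at hw
      simp only [F, Finset.coe_union, Set.Finite.coe_toFinset, Set.mem_union, Set.mem_ofPred_eq]
      tauto)]
  have h1 : ∀ w, G.p R ⟨Sum.inl ⁻¹' B, P.inl_preimage_mem hB⟩ * P.outerGap R w =
      (if Sum.inl w.1 ∈ B then 1 else 0 : ℤ) • P.outerGap R w := by
    intro w
    refine (p_mul_gap _ _ _).trans ?_
    simp only [Set.mem_preimage, ite_smul, one_smul, zero_smul]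
    rfl
  have h2 : ∀ w, P.outerGap R w * G.p R ⟨Sum.inl ⁻¹' B', P.inl_preimage_mem hB'⟩ =
      (if Sum.inl w.1 ∈ B' then 1 else 0 : ℤ) • P.outerGap R w := by
    intro w
    refine (gap_mul_p _ _ _).trans ?_
    simp only [Set.mem_preimage, ite_smul, one_smul, zero_smul]
    rfl
  have h3 : (∑ w ∈ F, P.coef B w • P.outerGap R w) * ∑ w ∈ F, P.coef B' w • P.outerGap R w =
      ∑ w ∈ F, (P.coef B w * P.coef B' w) • P.outerGap R w := by
    rw [Finset.sum_mul_sum]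
    refine Finset.sum_congr rfl fun w hw => ?_
    rw [Finset.sum_eq_single_of_mem w hw]
    · rw [smul_mul_smul_comm, outerGap_mul_outerGap, if_pos rfl]
    · intro w' _ hne
      rw [smul_mul_smul_comm, outerGap_mul_outerGap, if_neg hne.symm, smul_zero]
  rw [add_mul, mul_add, mul_add, h3, p_mul_p, Finset.mul_sum, Finset.sum_mul, add_assoc,
    ← Finset.sum_add_distrib, ← Finset.sum_add_distrib]
  congr 1
  refine Finset.sum_congr rfl fun w _ => ?_
  rw [mul_smul_comm, smul_mul_assoc, h1, h2, smul_smul, smul_smul, ← add_smul, ← add_smul]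
  congr 1
  simp only [coef, Set.mem_inter_iff]
  by_cases a : Sum.inr w ∈ B <;> by_cases b : Sum.inl w.1 ∈ B <;>
    by_cases c : Sum.inr w ∈ B' <;> by_cases d : Sum.inl w.1 ∈ B' <;> simp [a, b, c, d]

theorem barRep_union {B B' : Set P.BarVertex} (hB : B ∈ P.bar.sets) (hB' : B' ∈ P.bar.sets) :
    P.barRep R (B ∪ B') (union_mem_sets hB hB') = P.barRep R B hB + P.barRep R B' hB' -
      P.barRep R (B ∩ B') (inter_mem_sets hB hB') := by
  classical
  let F := (P.finite_separated hB).toFinset ∪ (P.finite_separated hB').toFinset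
  rw [P.barRep_eq hB (F := F) (fun w hw => by simpa [F] using Or.inl hw),
    P.barRep_eq hB' (F := F) (fun w hw => by simpa [F] using Or.inr hw),
    P.barRep_eq (inter_mem_sets hB hB') (F := F) (fun w hw => by
      simp only [Set.mem_inter_iff, Set.mem_ofPred_eq] at hw
      simp only [F, Finset.coe_union, Set.Finite.coe_toFinset, Set.mem_union, Set.mem_ofPred_eq]
      tauto),
    P.barRep_eq (union_mem_sets hB hB') (F := F) (fun w hw => by
      simp only [Set.mem_union, Set.mem_ofPred_eq] at hw
      simp only [F, Finset.coe_union, Set.Finite.coe_toFinset, Set.mem_union, Set.mem_ofPred_eq]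
      tauto)]
  have h1 : ∀ w, P.coef (B ∪ B') w = P.coef B w + P.coef B' w - P.coef (B ∩ B') w := by
    intro w
    simp only [coef, Set.mem_inter_iff, Set.mem_union]
    by_cases a : Sum.inr w ∈ B <;> by_cases b : Sum.inl w.1 ∈ B <;>
      by_cases c : Sum.inr w ∈ B' <;> by_cases d : Sum.inl w.1 ∈ B' <;> simp [a, b, c, d]
  have h2 := p_union (R := R) ⟨_, P.inl_preimage_mem hB⟩ ⟨_, P.inl_preimage_mem hB'⟩
  have h3 : G.p R ⟨Sum.inl ⁻¹' (B ∪ B'), P.inl_preimage_mem (union_mem_sets hB hB')⟩ =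
    G.p R ⟨Sum.inl ⁻¹' B, P.inl_preimage_mem hB⟩ +
      G.p R ⟨Sum.inl ⁻¹' B', P.inl_preimage_mem hB'⟩ -
      G.p R ⟨Sum.inl ⁻¹' (B ∩ B'), P.inl_preimage_mem (inter_mem_sets hB hB')⟩ := h2
  rw [h3]
  simp only [h1, sub_smul, add_smul, Finset.sum_sub_distrib, Finset.sum_add_distrib]
  abel

theorem barRep_mul_t {B : Set P.BarVertex} (hB : B ∈ P.bar.sets) {e : E} (he : G.r e ∉ P.H) :
    P.barRep R B hB * G.t R e =
      G.p R ⟨Sum.inl ⁻¹' B, P.inl_preimage_mem hB⟩ * G.t R e := by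
  rw [barRep, add_mul, Finset.sum_mul, Finset.sum_eq_zero, add_zero]
  intro w _
  rw [smul_mul_assoc, outerGap, gap_mul_t _ _ he, smul_zero]

theorem tStar_mul_barRep {B : Set P.BarVertex} (hB : B ∈ P.bar.sets) {e : E}
    (he : G.r e ∉ P.H) :
    G.tStar R e * P.barRep R B hB =
      G.tStar R e * G.p R ⟨Sum.inl ⁻¹' B, P.inl_preimage_mem hB⟩ := by
  rw [barRep, mul_add, Finset.mul_sum, Finset.sum_eq_zero, add_zero]
  intro w _
  rw [mul_smul_comm, outerGap, tStar_mul_gap _ _ he, smul_zero]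

/-- A breaking vertex `w` outside `S` corresponds to `p_w - p_w^H`, the sum of the `s_e s_{e^*}`
over the edges `e` emitted by `w` with range outside `H`. -/
theorem barRep_inl (w : ↥(G.breaking P.H \ P.S)) :
    P.barRep R {.inl w.1} (P.bar.singleton_mem_sets _) = G.pv R w.1 - P.outerGap R w := by
  rw [P.barRep_eq _ (F := {w}) (fun w' hw' => by
    simpa [← Subtype.ext_iff] using hw'), Finset.sum_singleton, sub_eq_add_neg]
  congr 1
  · exact p_congr (by ext; simp) _ _
  · simp [coef]

theorem barRep_inl_of_notMem {v : V} (hv : v ∉ G.breaking P.H \ P.S) :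
    P.barRep R {.inl v} (P.bar.singleton_mem_sets _) = G.pv R v := by
  rw [P.barRep_of_forall]
  · exact p_congr (by ext; simp) _ _
  · intro w
    simp only [Set.mem_singleton_iff, reduceCtorEq, Sum.inl.injEq, false_iff]
    exact fun h => hv (h ▸ w.2)

theorem p_mem_idealOf {A : G.sets} (hA : A.1 ∈ P.H) : G.p R A ∈ G.idealOf R P :=
  TwoSidedIdeal.subset_span (.inl ⟨A, hA, rfl⟩)

theorem gap_mem_idealOf {w : G.breaking P.H} (hw : w.1 ∈ P.S) :
    G.gap R P.H w ∈ G.idealOf R P :=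
  TwoSidedIdeal.subset_span (.inr ⟨w, hw, rfl⟩)

theorem t_mem_idealOf {e : E} (he : G.r e ∈ P.H) : G.t R e ∈ G.idealOf R P := by
  rw [← t_mul_p_r]
  exact TwoSidedIdeal.mul_mem_left _ _ _ (P.p_mem_idealOf he)

theorem mk_eq_zero {x : G.LeavittPathAlgebra R} :
    IdealQuotient.mk (G.idealOf R P) x = 0 ↔ x ∈ G.idealOf R P := by
  have := IdealQuotient.mk_eq_mk (G.idealOf R P) (x := x) (y := 0)
  rwa [map_zero, sub_zero] at this

/-- Modulo the ideal, the element `barRep B` depends on the class `[B]` only. -/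
theorem mk_barRep_congr {B B' : Set P.BarVertex} (hB : B ∈ P.bar.sets) (hB' : B' ∈ P.bar.sets)
    (h : ∃ W ∈ P.H, B ∪ Sum.inl '' W = B' ∪ Sum.inl '' W) :
    IdealQuotient.mk (G.idealOf R P) (P.barRep R B hB) =
      IdealQuotient.mk (G.idealOf R P) (P.barRep R B' hB') := by
  obtain ⟨W, hW, h⟩ := h
  have hWs := P.hereditary.subset_sets hW
  rw [← P.barSet_of_mem hW] at h
  have key : ∀ B hB, IdealQuotient.mk (G.idealOf R P) (P.barRep R B hB) =
      IdealQuotient.mk (G.idealOf R P)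
        (P.barRep R (B ∪ P.barSet W) (union_mem_sets hB (P.barSet_mem hWs))) := by
    intro B hB
    have h0 : IdealQuotient.mk (G.idealOf R P)
        (P.barRep R (P.barSet W) (P.barSet_mem hWs)) = 0 := by
      rw [mk_eq_zero, P.barRep_barSet ⟨W, hWs⟩]
      exact P.p_mem_idealOf hW
    rw [P.barRep_union hB (P.barSet_mem hWs), ← P.barRep_mul hB (P.barSet_mem hWs), map_sub,
      map_add, map_mul, h0, mul_zero, add_zero, sub_zero]
  rw [key B, key B']
  congr 2

variable (R) in
/-- The value of the inverse homomorphism on `q_A`. -/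
def ofClass : P.Class → IdealQuotient (G.idealOf R P) :=
  Quotient.lift (fun B => IdealQuotient.mk (G.idealOf R P) (P.barRep R B.1 B.2))
    fun B B' h => P.mk_barRep_congr B.2 B'.2 h

theorem ofClass_cls {B : Set P.BarVertex} (hB : B ∈ P.bar.sets) :
    P.ofClass R (P.cls B hB) = IdealQuotient.mk (G.idealOf R P) (P.barRep R B hB) := rfl

/-- The relation (LP4) for the edges of the quotient ultragraph holds modulo the ideal. -/
theorem mk_barRep_inl (v : V) (hne : {e | G.s e = v ∧ G.r e ∉ P.H}.Nonempty)
    (hfin : {e | G.s e = v ∧ G.r e ∉ P.H}.Finite) :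
    IdealQuotient.mk (G.idealOf R P) (P.barRep R {.inl v} (P.bar.singleton_mem_sets _)) =
      ∑ e ∈ hfin.toFinset, IdealQuotient.mk (G.idealOf R P) (G.t R e) *
        IdealQuotient.mk (G.idealOf R P) (G.tStar R e) := by
  simp only [← map_mul, ← map_sum]
  by_cases hv : {e | G.s e = v}.Finite
  · rw [P.barRep_inl_of_notMem fun h => h.1.1 hv, pv_eq_sum G R v (hne.mono fun e he => he.1) hv,
      map_sum, map_sum]
    refine (Finset.sum_subset (fun e he => ?_) fun e _ he => ?_).symm
    · simp only [Set.Finite.mem_toFinset] at he ⊢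
      exact he.1
    · have hs : G.s e = v := by simpa using ‹e ∈ hv.toFinset›
      have hr : G.r e ∈ P.H := by
        by_contra hr
        exact he (hfin.mem_toFinset.2 ⟨hs, hr⟩)
      rw [map_mul, P.mk_eq_zero.2 (P.t_mem_idealOf hr), zero_mul]
  · have hb : v ∈ G.breaking P.H := ⟨hv, hne, hfin⟩
    by_cases hS : v ∈ P.S
    · rw [P.barRep_inl_of_notMem fun h => h.2 hS, IdealQuotient.mk_eq_mk]
      exact P.gap_mem_idealOf (w := ⟨v, hb⟩) hS
    · rw [P.barRep_inl ⟨v, hb, hS⟩, outerGap, gap_eq, sub_sub_cancel]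

variable (R) in
/-- The images of the generators of the algebra of the quotient ultragraph in the quotient
of `L_R(𝒢)`. -/
def ofQuotientFamily : LeavittFamily P.quotient (IdealQuotient (G.idealOf R P)) where
  p A _ := P.ofClass R A
  t e := IdealQuotient.mk _ (G.t R e.1)
  tStar e := IdealQuotient.mk _ (G.tStar R e.1)
  p_empty := (congrArg (IdealQuotient.mk (G.idealOf R P))
    ((P.barRep_barSet ⟨∅, .empty⟩).trans (p_empty G R))).trans (map_zero _)
  p_inter A A' _ _ := by
    obtain ⟨B, hB, rfl⟩ := P.exists_cls A
    obtain ⟨B', hB', rfl⟩ := P.exists_cls A'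
    rw [ofClass_cls, ofClass_cls, ← map_mul, barRep_mul]
    rfl
  p_union A A' _ _ := by
    obtain ⟨B, hB, rfl⟩ := P.exists_cls A
    obtain ⟨B', hB', rfl⟩ := P.exists_cls A'
    refine (congrArg (IdealQuotient.mk (G.idealOf R P)) (P.barRep_union hB hB')).trans ?_
    rw [map_sub, map_add]
    rfl
  p_s_mul_t e := by
    change P.ofClass R (P.vertexClass (P.bar.s e.1)) * _ = _
    rw [P.bar_s e.2, vertexClass, ofClass_cls, ← map_mul, P.barRep_mul_t _ e.2, p_mul_t, if_pos]
    exact Set.mem_singleton _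
  t_mul_p_r e := by
    change _ * IdealQuotient.mk (G.idealOf R P)
      (P.barRep R (P.barSet (G.r e.1)) (P.barSet_mem (G.r_mem_sets e.1))) = _
    rw [P.barRep_barSet ⟨G.r e.1, G.r_mem_sets e.1⟩, ← map_mul, t_mul_p_r]
  p_r_mul_tStar e := by
    change IdealQuotient.mk (G.idealOf R P)
      (P.barRep R (P.barSet (G.r e.1)) (P.barSet_mem (G.r_mem_sets e.1))) * _ = _
    rw [P.barRep_barSet ⟨G.r e.1, G.r_mem_sets e.1⟩, ← map_mul, p_r_mul_tStar]
  tStar_mul_p_s e := by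
    change _ * P.ofClass R (P.vertexClass (P.bar.s e.1)) = _
    rw [P.bar_s e.2, vertexClass, ofClass_cls, ← map_mul, P.tStar_mul_barRep _ e.2, tStar_mul_p,
      if_pos]
    exact Set.mem_singleton _
  tStar_mul_t e := by
    change _ = IdealQuotient.mk (G.idealOf R P)
      (P.barRep R (P.barSet (G.r e.1)) (P.barSet_mem (G.r_mem_sets e.1)))
    rw [P.barRep_barSet ⟨G.r e.1, G.r_mem_sets e.1⟩, ← map_mul, tStar_mul_t]
  tStar_mul_t_of_ne e f hef := by
    rw [← map_mul, tStar_mul_t_of_ne G R fun h => hef (Subtype.ext h), map_zero]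
  p_vert := by
    rintro _ (⟨v, hv, rfl⟩ | ⟨w, rfl⟩) hne hfin
    · have hset : {e | G.s e = v ∧ G.r e ∉ P.H} =
          Subtype.val '' {e | P.quotient.s e = P.vertexClass (.inl v)} := by
        ext e
        constructor
        · exact fun he => ⟨⟨e, he.2⟩, (P.quotient_s_eq_iff hv _).2 he.1, rfl⟩
        · rintro ⟨e, he, rfl⟩
          exact ⟨(P.quotient_s_eq_iff hv _).1 he, e.2⟩
      have hfin' : {e | G.s e = v ∧ G.r e ∉ P.H}.Finite := hset ▸ hfin.image _
      refine (P.mk_barRep_inl v (hset ▸ hne.image _) hfin').trans ?_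
      refine (Finset.sum_of_injOn Subtype.val Subtype.val_injective.injOn ?_ ?_ ?_).symm
      · intro e he
        exact hfin'.mem_toFinset.2 (hset.symm.subset ⟨e, hfin.mem_toFinset.1 he, rfl⟩)
      · intro e he hne
        refine absurd ?_ hne
        rw [Set.Finite.coe_toFinset, ← hset]
        exact hfin'.mem_toFinset.1 he
      · exact fun e _ => rfl
    · obtain ⟨e, he⟩ := hne
      have h1 : P.vertexClass (P.bar.s e.1) = P.vertexClass (.inr w) := he
      have h2 := P.eq_of_vertexClass_eq h1.symm (P.vertexClass_inr_ne_empty w)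
      rw [P.bar_s e.2] at h2
      exact (Sum.inr_ne_inl h2).elim

variable (R) in
/-- The homomorphism from the algebra of the quotient ultragraph to the quotient of `L_R(𝒢)`. -/
def ofQuotient : P.quotient.LeavittAlgebra R →ₙₐ[R] IdealQuotient (G.idealOf R P) :=
  (P.ofQuotientFamily R).lift R

theorem ofQuotient_q {B : Set P.BarVertex} (hB : B ∈ P.bar.sets) :
    P.ofQuotient R (P.q R B hB) = IdealQuotient.mk _ (P.barRep R B hB) :=
  LeavittFamily.lift_p _ _

theorem ofQuotient_toQuotient (x : G.LeavittPathAlgebra R) :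
    P.ofQuotient R (P.toQuotient R x) = IdealQuotient.mk (G.idealOf R P) x := by
  induction x using LeavittAlgebra.induction with
  | hp A =>
    refine (congrArg _ (P.toQuotient_p A)).trans ?_
    exact (P.ofQuotient_q _).trans (congrArg _ (P.barRep_barSet A))
  | ht e =>
    refine (congrArg _ (P.toQuotient_t e)).trans ?_
    by_cases h : G.r e ∈ P.H
    · rw [P.qt_of_mem h, map_zero]
      exact (P.mk_eq_zero.2 (P.t_mem_idealOf h)).symm
    · rw [P.qt_of_notMem h]
      exact LeavittFamily.lift_t _ _
  | hts e =>
    refine (congrArg _ (P.toQuotient_tStar e)).trans ?_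
    by_cases h : G.r e ∈ P.H
    · rw [P.qtStar_of_mem h, map_zero]
      refine (P.mk_eq_zero.2 ?_).symm
      change G.tStar R e ∈ _
      rw [← p_r_mul_tStar]
      exact TwoSidedIdeal.mul_mem_right _ _ _ (P.p_mem_idealOf h)
    · rw [P.qtStar_of_notMem h]
      exact LeavittFamily.lift_tStar _ _
  | zero => simp only [map_zero]
  | add x y hx hy => simp only [map_add, hx, hy]
  | smul c x hx => rw [map_smul, map_smul, hx, IdealQuotient.mk_smul]
  | mul x y hx hy => simp only [map_mul, hx, hy]

theorem toQuotient_eq_zero_iff {x : G.LeavittPathAlgebra R} :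
    P.toQuotient R x = 0 ↔ x ∈ G.idealOf R P := by
  refine ⟨fun h => ?_, P.toQuotient_eq_zero_of_mem⟩
  rw [← mk_eq_zero, ← ofQuotient_toQuotient, h, map_zero]

theorem ofQuotient_injective : Function.Injective (P.ofQuotient R) := by
  refine (injective_iff_map_eq_zero _).2 fun y hy => ?_
  obtain ⟨x, rfl⟩ := P.toQuotient_surjective y
  rwa [ofQuotient_toQuotient, mk_eq_zero, ← toQuotient_eq_zero_iff] at hy

theorem ofQuotient_surjective : Function.Surjective (P.ofQuotient R) := by
  intro y
  obtain ⟨x, rfl⟩ := IdealQuotient.mk_surjective _ y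
  exact ⟨_, P.ofQuotient_toQuotient x⟩

theorem toQuotient_barRep {B : Set P.BarVertex} (hB : B ∈ P.bar.sets) :
    P.toQuotient R (P.barRep R B hB) = P.q R B hB :=
  P.ofQuotient_injective (by rw [ofQuotient_toQuotient, ofQuotient_q])

end AdmissiblePair

end Ultragraph

/-! ### The grading -/

namespace Ultragraph

open UltragraphData

variable {V E : Type*} {G : Ultragraph V E} {R : Type*} [CommRing R]

theorem monomial_cons (e : E) (α : List E) (A : G.sets) (β : List E) :
    G.monomial R (e :: α) A β = G.t R e * G.monomial R α A β := rfl

theorem monomial_nil_cons (A : G.sets) (e : E) (β : List E) :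
    G.monomial R [] A (e :: β) = G.monomial R [] A β * G.tStar R e := rfl

theorem monomial_nil_nil (A : G.sets) : G.monomial R [] A [] = G.p R A := rfl

theorem monomial_nil_of_not_isPath (A : G.sets) {β : List E} (h : ¬ G.IsPath β) :
    G.monomial R [] A β = 0 := by
  induction β with
  | nil => exact absurd List.isChain_nil h
  | cons e β ih =>
    by_cases hβ : G.IsPath β
    · cases β with
      | nil => exact absurd (List.isChain_singleton e) h
      | cons f β =>
        have hs : G.s f ∉ G.r e := fun hs => h (List.isChain_cons_cons.2 ⟨hs, hβ⟩)
        rw [monomial_nil_cons, monomial_nil_cons, ← p_r_mul_tStar G R e, mul_assoc,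
          ← mul_assoc (G.tStar R f), tStar_mul_p, if_neg hs, zero_mul, mul_zero]
    · rw [monomial_nil_cons, ih hβ, zero_mul]

theorem monomial_of_not_isPath {α : List E} (h : ¬ G.IsPath α) (A : G.sets) (β : List E) :
    G.monomial R α A β = 0 := by
  induction α with
  | nil => exact absurd List.isChain_nil h
  | cons e α ih =>
    by_cases hα : G.IsPath α
    · cases α with
      | nil => exact absurd (List.isChain_singleton e) h
      | cons f α =>
        have hs : G.s f ∉ G.r e := fun hs => h (List.isChain_cons_cons.2 ⟨hs, hα⟩)
        rw [monomial_cons, monomial_cons, ← t_mul_p_r G R e, mul_assoc,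
          ← mul_assoc (G.p R _), p_mul_t, if_neg hs, zero_mul, mul_zero]
    · rw [monomial_cons, ih hα, mul_zero]

theorem monomial_mem_homogeneous (α : List E) (A : G.sets) (β : List E) {n : ℤ}
    (hn : (α.length : ℤ) - β.length = n) : G.monomial R α A β ∈ G.homogeneous R n := by
  by_cases hα : G.IsPath α
  · by_cases hβ : G.IsPath β
    · exact Submodule.subset_span ⟨α, β, A, hα, hβ, hn, rfl⟩
    · have h0 : G.monomial R α A β = 0 := by
        clear hα hn
        induction α with
        | nil => exact monomial_nil_of_not_isPath A hβ
        | cons e α ih => rw [monomial_cons, ih, mul_zero]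
      rw [h0]
      exact zero_mem _
  · rw [monomial_of_not_isPath hα]
    exact zero_mem _

theorem p_mul_monomial_nil (A A' : G.sets) (β : List E) :
    G.p R A * G.monomial R [] A' β =
      G.monomial R [] ⟨A.1 ∩ A'.1, inter_mem_sets A.2 A'.2⟩ β := by
  induction β with
  | nil => exact p_mul_p A A'
  | cons e β ih => rw [monomial_nil_cons, ← mul_assoc, ih, monomial_nil_cons]

open Classical in
theorem tStar_mul_monomial_nil (e : E) (A : G.sets) (β : List E) :
    G.tStar R e * G.monomial R [] A β =
      if G.s e ∈ A.1 then G.monomial R [] ⟨G.r e, G.r_mem_sets e⟩ (β ++ [e]) else 0 := by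
  induction β with
  | nil =>
    rw [monomial_nil_nil, tStar_mul_p, List.nil_append, monomial_nil_cons, monomial_nil_nil,
      p_r_mul_tStar]
  | cons f β ih =>
    rw [monomial_nil_cons, ← mul_assoc, ih, List.cons_append, monomial_nil_cons]
    split_ifs
    exacts [rfl, zero_mul _]

theorem p_mul_monomial_mem (A' : G.sets) (α : List E) (A : G.sets) (β : List E) {n : ℤ}
    (hn : (α.length : ℤ) - β.length = n) :
    G.p R A' * G.monomial R α A β ∈ G.homogeneous R n := by
  cases α with
  | nil =>
    rw [p_mul_monomial_nil]
    exact monomial_mem_homogeneous _ _ _ hn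
  | cons e α =>
    rw [monomial_cons, ← mul_assoc, p_mul_t]
    split_ifs
    · exact monomial_mem_homogeneous (e :: α) _ _ hn
    · rw [zero_mul]
      exact zero_mem _

theorem tStar_mul_monomial_mem (e : E) (α : List E) (A : G.sets) (β : List E) {n : ℤ}
    (hn : (α.length : ℤ) - β.length = n) :
    G.tStar R e * G.monomial R α A β ∈ G.homogeneous R (n - 1) := by
  cases α with
  | nil =>
    rw [tStar_mul_monomial_nil]
    split_ifs
    · refine monomial_mem_homogeneous _ _ _ ?_
      simp only [List.length_nil, List.length_append, List.length_singleton] at hn ⊢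
      push_cast at hn ⊢
      omega
    · exact zero_mem _
  | cons f α =>
    rw [monomial_cons, ← mul_assoc]
    by_cases h : e = f
    · subst h
      rw [tStar_mul_t]
      refine p_mul_monomial_mem _ _ _ _ ?_
      simp only [List.length_cons] at hn
      push_cast at hn
      omega
    · rw [tStar_mul_t_of_ne G R h, zero_mul]
      exact zero_mem _

theorem homogeneous_induction {n : ℤ} {S : Submodule R (G.LeavittPathAlgebra R)}
    (h : ∀ α A β, (α.length : ℤ) - β.length = n → G.monomial R α A β ∈ S) :
    G.homogeneous R n ≤ S := by
  refine Submodule.span_le.2 ?_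
  rintro _ ⟨α, β, A, _, _, hn, rfl⟩
  exact h α A β hn

theorem p_mul_mem_homogeneous (A : G.sets) {n : ℤ} {x : G.LeavittPathAlgebra R}
    (hx : x ∈ G.homogeneous R n) : G.p R A * x ∈ G.homogeneous R n :=
  homogeneous_induction (S := (G.homogeneous R n).comap (LinearMap.mulLeft R (G.p R A)))
    (fun α A' β hn => p_mul_monomial_mem A α A' β hn) hx

theorem t_mul_mem_homogeneous (e : E) {n : ℤ} {x : G.LeavittPathAlgebra R}
    (hx : x ∈ G.homogeneous R n) : G.t R e * x ∈ G.homogeneous R (n + 1) := by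
  refine homogeneous_induction
    (S := (G.homogeneous R (n + 1)).comap (LinearMap.mulLeft R (G.t R e))) ?_ hx
  intro α A β hn
  refine monomial_mem_homogeneous (e :: α) A β ?_
  rw [List.length_cons]
  push_cast
  omega

theorem tStar_mul_mem_homogeneous (e : E) {n : ℤ} {x : G.LeavittPathAlgebra R}
    (hx : x ∈ G.homogeneous R n) : G.tStar R e * x ∈ G.homogeneous R (n - 1) :=
  homogeneous_induction
    (S := (G.homogeneous R (n - 1)).comap (LinearMap.mulLeft R (G.tStar R e)))
    (fun α A β hn => tStar_mul_monomial_mem e α A β hn) hx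

theorem mul_mem_homogeneous {m n : ℤ} {x y : G.LeavittPathAlgebra R}
    (hx : x ∈ G.homogeneous R m) (hy : y ∈ G.homogeneous R n) :
    x * y ∈ G.homogeneous R (m + n) := by
  refine homogeneous_induction
    (S := (G.homogeneous R (m + n)).comap (LinearMap.mulRight R y)) ?_ hx
  intro α A β hm
  change G.monomial R α A β * y ∈ G.homogeneous R (m + n)
  clear hx
  induction α generalizing m with
  | nil =>
    induction β generalizing m n y with
    | nil =>
      obtain rfl : 0 = m := by simpa using hm
      rw [zero_add]
      exact p_mul_mem_homogeneous A hy
    | cons e β ih =>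
      rw [monomial_nil_cons, mul_assoc]
      simp only [List.length_cons] at hm
      push_cast at hm
      have h := ih (m := m + 1) (tStar_mul_mem_homogeneous e hy) (by omega)
      rwa [show m + 1 + (n - 1) = m + n by ring] at h
  | cons e α ih =>
    rw [monomial_cons, mul_assoc]
    simp only [List.length_cons] at hm
    push_cast at hm
    have h := t_mul_mem_homogeneous e (ih (m := m - 1) (by omega))
    rwa [show m - 1 + n + 1 = m + n by ring] at h

theorem p_mem_homogeneous (A : G.sets) : G.p R A ∈ G.homogeneous R 0 :=
  monomial_mem_homogeneous [] A [] (by simp)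

theorem t_mem_homogeneous (e : E) : G.t R e ∈ G.homogeneous R 1 := by
  rw [← t_mul_p_r]
  exact monomial_mem_homogeneous [e] _ [] (by simp)

theorem tStar_mem_homogeneous (e : E) : G.tStar R e ∈ G.homogeneous R (-1) := by
  rw [← p_r_mul_tStar]
  exact monomial_mem_homogeneous [] _ [e] (by simp)

theorem gap_mem_homogeneous (H : Set (Set V)) (w : G.breaking H) :
    G.gap R H w ∈ G.homogeneous R 0 := by
  refine sub_mem (p_mem_homogeneous _) (sum_mem fun e _ => ?_)
  have h := mul_mem_homogeneous (t_mem_homogeneous (G := G) (R := R) e) (tStar_mem_homogeneous e)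
  rwa [add_neg_cancel] at h

/-- The part of degree `n` of an ideal. -/
def gradedPart (I : TwoSidedIdeal (G.LeavittPathAlgebra R)) (n : ℤ) :
    Submodule R (G.LeavittPathAlgebra R) where
  carrier := {x | x ∈ I ∧ x ∈ G.homogeneous R n}
  add_mem' hx hy := ⟨I.add_mem hx.1 hy.1, add_mem hx.2 hy.2⟩
  zero_mem' := ⟨I.zero_mem, zero_mem _⟩
  smul_mem' c _ hx := ⟨SMulClosed.smul_mem c hx.1, Submodule.smul_mem _ c hx.2⟩

theorem mul_mem_iSup_gradedPart (I : TwoSidedIdeal (G.LeavittPathAlgebra R))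
    (z : G.LeavittPathAlgebra R) {x : G.LeavittPathAlgebra R} (hx : x ∈ ⨆ n, gradedPart I n) :
    z * x ∈ ⨆ n, gradedPart I n := by
  have key : ∀ (d : ℤ) (z : G.LeavittPathAlgebra R), z ∈ G.homogeneous R d →
      ∀ x ∈ ⨆ n, gradedPart I n, z * x ∈ ⨆ n, gradedPart I n := by
    intro d z hz x hx
    suffices h : ⨆ n, gradedPart I n ≤ (⨆ n, gradedPart I n).comap (LinearMap.mulLeft R z) from
      h hx
    refine iSup_le fun n x hx => ?_
    exact Submodule.mem_iSup_of_mem (d + n) ⟨I.mul_mem_left _ _ hx.1, mul_mem_homogeneous hz hx.2⟩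
  induction z using LeavittAlgebra.induction generalizing x with
  | hp A => exact key 0 _ (p_mem_homogeneous A) x hx
  | ht e => exact key 1 _ (t_mem_homogeneous e) x hx
  | hts e => exact key (-1) _ (tStar_mem_homogeneous e) x hx
  | zero =>
    rw [zero_mul]
    exact zero_mem _
  | add z z' h h' =>
    rw [add_mul]
    exact add_mem (h hx) (h' hx)
  | smul c z h =>
    rw [smul_mul_assoc]
    exact Submodule.smul_mem _ c (h hx)
  | mul z z' h h' =>
    rw [mul_assoc]
    exact h (h' hx)

theorem iSup_gradedPart_mul_mem (I : TwoSidedIdeal (G.LeavittPathAlgebra R))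
    (z : G.LeavittPathAlgebra R) {x : G.LeavittPathAlgebra R} (hx : x ∈ ⨆ n, gradedPart I n) :
    x * z ∈ ⨆ n, gradedPart I n := by
  have key : ∀ (d : ℤ) (z : G.LeavittPathAlgebra R), z ∈ G.homogeneous R d →
      ∀ x ∈ ⨆ n, gradedPart I n, x * z ∈ ⨆ n, gradedPart I n := by
    intro d z hz x hx
    suffices h : ⨆ n, gradedPart I n ≤ (⨆ n, gradedPart I n).comap (LinearMap.mulRight R z) from
      h hx
    refine iSup_le fun n x hx => ?_
    exact Submodule.mem_iSup_of_mem (n + d)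
      ⟨I.mul_mem_right _ _ hx.1, mul_mem_homogeneous hx.2 hz⟩
  induction z using LeavittAlgebra.induction generalizing x with
  | hp A => exact key 0 _ (p_mem_homogeneous A) x hx
  | ht e => exact key 1 _ (t_mem_homogeneous e) x hx
  | hts e => exact key (-1) _ (tStar_mem_homogeneous e) x hx
  | zero =>
    rw [mul_zero]
    exact zero_mem _
  | add z z' h h' =>
    rw [mul_add]
    exact add_mem (h hx) (h' hx)
  | smul c z h =>
    rw [mul_smul_comm]
    exact Submodule.smul_mem _ c (h hx)
  | mul z z' h h' =>
    rw [← mul_assoc]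
    exact h' (h hx)

/-- An ideal which is generated by homogeneous elements is graded. -/
theorem isGraded_span {S : Set (G.LeavittPathAlgebra R)}
    (hS : ∀ x ∈ S, ∃ n, x ∈ G.homogeneous R n) : G.IsGraded (TwoSidedIdeal.span S) := by
  let I := TwoSidedIdeal.span S
  let K : TwoSidedIdeal (G.LeavittPathAlgebra R) :=
    .mk' (⨆ n, gradedPart I n : Submodule R (G.LeavittPathAlgebra R)) (zero_mem _)
      (fun hx hy => add_mem hx hy) (fun hx => neg_mem hx)
      (fun {x _} hy => mul_mem_iSup_gradedPart I x hy)
      (fun {_ y} hx => iSup_gradedPart_mul_mem I y hx)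
  intro x hx
  have hxK : x ∈ K := by
    refine TwoSidedIdeal.mem_span_iff.1 hx K fun y hy => ?_
    obtain ⟨n, hn⟩ := hS y hy
    refine (TwoSidedIdeal.mem_mk' ..).2 ?_
    exact Submodule.mem_iSup_of_mem (p := gradedPart I) n ⟨TwoSidedIdeal.subset_span hy, hn⟩
  have hxK' : x ∈ ⨆ n, gradedPart I n := (TwoSidedIdeal.mem_mk' ..).1 hxK
  obtain ⟨f, hf, rfl⟩ := (Submodule.mem_iSup_iff_exists_finsupp _ _).1 hxK'
  exact ⟨f, hf, rfl⟩

/-! ### The lattice of graded basic ideals -/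

namespace AdmissiblePair

variable (P : G.AdmissiblePair)

theorem isGraded_idealOf : G.IsGraded (G.idealOf R P) := by
  refine isGraded_span ?_
  rintro _ (⟨A, _, rfl⟩ | ⟨w, _, rfl⟩)
  · exact ⟨0, p_mem_homogeneous A⟩
  · exact ⟨0, gap_mem_homogeneous _ w⟩

theorem smul_p_mem_idealOf {A : G.sets} {c : R} (h : c • G.p R A ∈ G.idealOf R P) :
    c = 0 ∨ A.1 ∈ P.H := by
  rw [← toQuotient_eq_zero_iff, map_smul, toQuotient_p] at h
  exact (P.quotientModel.smul_p_eq_zero h).imp_right (P.cls_barSet_eq_empty A.2).1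

theorem smul_gap_mem_idealOf {w : G.breaking P.H} {c : R}
    (h : c • G.gap R P.H w ∈ G.idealOf R P) : c = 0 ∨ w.1 ∈ P.S := by
  by_cases hw : w.1 ∈ P.S
  · exact .inr hw
  rw [← toQuotient_eq_zero_iff, map_smul, P.toQuotient_gap_of_notMem ⟨w.1, w.2, hw⟩] at h
  exact .inl ((P.quotientModel.smul_p_eq_zero h).resolve_right (P.vertexClass_inr_ne_empty _))

theorem collectionOf_idealOf [Nontrivial R] : G.collectionOf (G.idealOf R P) = P.H := by
  ext A
  constructor
  · rintro ⟨hA, h⟩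
    rw [← one_smul R (G.p R _)] at h
    exact (P.smul_p_mem_idealOf h).resolve_left one_ne_zero
  · intro h
    exact ⟨P.hereditary.subset_sets h, P.p_mem_idealOf h⟩

theorem smul_gap_mem_idealOf_of_eq {H : Set (Set V)} (hH : H = P.H) {w : G.breaking H} {c : R}
    (hc : c ≠ 0) : c • G.gap R H w ∈ G.idealOf R P ↔ w.1 ∈ P.S := by
  subst hH
  refine ⟨fun h => (P.smul_gap_mem_idealOf h).resolve_left hc, fun h => ?_⟩
  exact SMulClosed.smul_mem c (P.gap_mem_idealOf h)

theorem gap_mem_idealOf_of_eq [Nontrivial R] {H : Set (Set V)} (hH : H = P.H)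
    {w : G.breaking H} : G.gap R H w ∈ G.idealOf R P ↔ w.1 ∈ P.S := by
  rw [← P.smul_gap_mem_idealOf_of_eq (R := R) hH one_ne_zero, one_smul]

theorem isBasic_idealOf [Nontrivial R] : G.IsBasic (G.idealOf R P) := by
  constructor
  · intro A c hc h
    exact P.p_mem_idealOf ((P.smul_p_mem_idealOf h).resolve_left hc)
  · intro w c hc h
    rw [P.smul_gap_mem_idealOf_of_eq P.collectionOf_idealOf hc] at h
    exact (P.gap_mem_idealOf_of_eq P.collectionOf_idealOf).2 h

theorem idealOf_injective [Nontrivial R] {P P' : G.AdmissiblePair}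
    (h : G.idealOf R P = G.idealOf R P') : P = P' := by
  have hH : P.H = P'.H := by
    rw [← P.collectionOf_idealOf (R := R), h, P'.collectionOf_idealOf]
  refine AdmissiblePair.ext hH (Set.ext fun w => ⟨fun hw => ?_, fun hw => ?_⟩)
  · refine (P'.gap_mem_idealOf_of_eq (R := R) hH (w := ⟨w, P.subset_breaking hw⟩)).1 ?_
    rw [← h]
    exact P.gap_mem_idealOf hw
  · refine (P.gap_mem_idealOf_of_eq (R := R) hH.symm (w := ⟨w, P'.subset_breaking hw⟩)).1 ?_
    rw [h]
    exact P'.gap_mem_idealOf hw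

theorem toQuotient_mem_degreePart {n : ℤ} {x : G.LeavittPathAlgebra R}
    (hx : x ∈ G.homogeneous R n) :
    ∃ N, P.toQuotient R x ∈ LeavittAlgebra.degreePart P.quotient R n N := by
  induction hx using Submodule.span_induction with
  | mem x h =>
    obtain ⟨α, β, A, -, -, rfl, rfl⟩ := h
    refine ⟨β.length, ?_⟩
    induction α with
    | nil =>
      induction β with
      | nil =>
        rw [monomial_nil_nil, toQuotient_p]
        exact LeavittAlgebra.p_mem_degreePart _
      | cons e β ih =>
        rw [monomial_nil_cons, map_mul, toQuotient_tStar]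
        by_cases he : G.r e ∈ P.H
        · rw [P.qtStar_of_mem he, mul_zero]
          exact zero_mem _
        · rw [P.qtStar_of_notMem he]
          have h := LeavittAlgebra.mul_tStar_mem_degreePart ih (⟨e, he⟩ : {e // G.r e ∉ P.H})
          rw [List.length_cons]
          push_cast
          rwa [sub_sub] at h
    | cons e α ih =>
      rw [monomial_cons, map_mul, toQuotient_t]
      by_cases he : G.r e ∈ P.H
      · rw [P.qt_of_mem he, zero_mul]
        exact zero_mem _
      · rw [P.qt_of_notMem he]
        have h := LeavittAlgebra.t_mul_mem_degreePart (⟨e, he⟩ : {e // G.r e ∉ P.H}) _ _ ih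
        rw [List.length_cons]
        push_cast
        rwa [sub_add_eq_add_sub] at h
  | zero => exact ⟨0, by rw [map_zero]; exact zero_mem _⟩
  | add x y _ _ hx hy =>
    obtain ⟨N, hN⟩ := hx
    obtain ⟨N', hN'⟩ := hy
    refine ⟨max N N', ?_⟩
    rw [map_add]
    exact add_mem (LeavittAlgebra.degreePart_mono n (le_max_left _ _) hN)
      (LeavittAlgebra.degreePart_mono n (le_max_right _ _) hN')
  | smul c x _ hx =>
    obtain ⟨N, hN⟩ := hx
    refine ⟨N, ?_⟩
    rw [map_smul]
    exact Submodule.smul_mem _ c hN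

open Classical in
theorem barRep_mul_outerGap {B : Set P.BarVertex} (hB : B ∈ P.bar.sets)
    (w : ↥(G.breaking P.H \ P.S)) :
    P.barRep R B hB * P.outerGap R w = if Sum.inr w ∈ B then P.outerGap R w else 0 := by
  rw [P.barRep_eq hB (F := insert w (P.finite_separated hB).toFinset) (fun w hw => by
    simpa using Or.inr hw), add_mul, Finset.sum_mul, Finset.sum_eq_single_of_mem w
    (Finset.mem_insert_self _ _), smul_mul_assoc, outerGap_mul_outerGap, if_pos rfl,
    outerGap, p_mul_gap, coef]
  · simp only [Set.mem_preimage]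
    split_ifs <;> simp
  · intro w' _ hne
    rw [smul_mul_assoc, outerGap_mul_outerGap, if_neg hne, smul_zero]

/-- The pair `(H_I, {w : p_w^{H_I} ∈ I})`. -/
def ofIdeal (I : TwoSidedIdeal (G.LeavittPathAlgebra R)) : G.AdmissiblePair where
  H := G.collectionOf I
  S := {w | ∃ h : w ∈ G.breaking (G.collectionOf I), G.gap R _ ⟨w, h⟩ ∈ I}
  hereditary :=
    { subset_sets := fun _ h => h.1
      empty_mem := ⟨.empty, by rw [p_empty]; exact I.zero_mem⟩
      range_mem := fun e ⟨_, h⟩ => ⟨G.r_mem_sets e, by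
        rw [← tStar_mul_t, ← pv_mul_t]
        exact I.mul_mem_left _ _ (I.mul_mem_right _ _ h)⟩
      union_mem := fun A ⟨hA, h⟩ A' ⟨hA', h'⟩ => ⟨union_mem_sets hA hA', by
        have h1 := p_union (R := R) ⟨A, hA⟩ ⟨A', hA'⟩
        rw [← p_mul_p] at h1
        rw [h1]
        exact I.sub_mem (I.add_mem h h') (I.mul_mem_left _ _ h')⟩
      mem_of_subset := fun A ⟨hA, h⟩ A' hA' hs => ⟨hA', by
        have h1 := p_mul_p (R := R) ⟨A', hA'⟩ ⟨A, hA⟩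
        rw [p_congr (Set.inter_eq_self_of_subset_left hs) _ hA'] at h1
        rw [← h1]
        exact I.mul_mem_left _ _ h⟩ }
  saturated v hne hfin h := ⟨G.singleton_mem_sets v, by
    change G.pv R v ∈ I
    rw [pv_eq_sum G R v hne hfin]
    refine sum_mem fun e he => I.mul_mem_right _ _ ?_
    obtain ⟨_, he'⟩ := h e (hfin.mem_toFinset.1 he)
    rw [← t_mul_p_r]
    exact I.mul_mem_left _ _ he'⟩
  subset_breaking _ h := h.1

theorem idealOf_ofIdeal_le (I : TwoSidedIdeal (G.LeavittPathAlgebra R)) :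
    G.idealOf R (ofIdeal I) ≤ I := by
  refine TwoSidedIdeal.span_le.2 ?_
  rintro _ (⟨A, ⟨_, hA⟩, rfl⟩ | ⟨w, ⟨_, hw⟩, rfl⟩)
  exacts [hA, hw]

/-- The image of an ideal in the algebra of the quotient ultragraph. -/
def mapIdeal (I : TwoSidedIdeal (G.LeavittPathAlgebra R)) :
    TwoSidedIdeal (P.quotient.LeavittAlgebra R) :=
  .mk' (P.toQuotient R '' I) ⟨0, I.zero_mem, map_zero _⟩
    (by
      rintro _ _ ⟨x, hx, rfl⟩ ⟨y, hy, rfl⟩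
      exact ⟨x + y, I.add_mem hx hy, map_add _ _ _⟩)
    (by
      rintro _ ⟨x, hx, rfl⟩
      exact ⟨-x, I.neg_mem hx, map_neg _ _⟩)
    (by
      rintro z _ ⟨y, hy, rfl⟩
      obtain ⟨x, rfl⟩ := P.toQuotient_surjective z
      exact ⟨x * y, I.mul_mem_left _ _ hy, map_mul _ _ _⟩)
    (by
      rintro _ z ⟨x, hx, rfl⟩
      obtain ⟨y, rfl⟩ := P.toQuotient_surjective z
      exact ⟨x * y, I.mul_mem_right _ _ hx, map_mul _ _ _⟩)

theorem mem_mapIdeal {I : TwoSidedIdeal (G.LeavittPathAlgebra R)}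
    {y : P.quotient.LeavittAlgebra R} : y ∈ P.mapIdeal I ↔ ∃ x ∈ I, P.toQuotient R x = y :=
  TwoSidedIdeal.mem_mk' ..

/-- For a basic ideal `I` with pair `(H, S)`, the image of `I` in the algebra of the quotient
ultragraph contains no non-zero multiples of idempotents. -/
theorem smul_p_mem_mapIdeal {I : TwoSidedIdeal (G.LeavittPathAlgebra R)} (hI : G.IsBasic I)
    (A : (ofIdeal I).quotient.alg) (c : R)
    (h : c • LeavittAlgebra.p (ofIdeal I).quotient R A ∈ (ofIdeal I).mapIdeal I) :
    c = 0 ∨ A.1 = ∅ := by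
  by_cases hc : c = 0
  · exact .inl hc
  right
  obtain ⟨A, hA⟩ := A
  obtain ⟨B, hB, rfl⟩ := (ofIdeal I).exists_cls A
  have hBI : c • (ofIdeal I).barRep R B hB ∈ I := by
    obtain ⟨x, hx, hxq⟩ := (ofIdeal I).mem_mapIdeal.1 h
    have h1 : c • (ofIdeal I).barRep R B hB - x ∈ G.idealOf R (ofIdeal I) := by
      rw [← toQuotient_eq_zero_iff, map_sub, map_smul, toQuotient_barRep, hxq, sub_eq_zero]
      rfl
    have h2 := I.add_mem (idealOf_ofIdeal_le I h1) hx
    rwa [sub_add_cancel] at h2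
  -- A point `w'` of `B` would put `p_w^H` into `I`, hence `w` into `S`.
  have hr : ∀ w : ↥(G.breaking (ofIdeal I).H \ (ofIdeal I).S), Sum.inr w ∉ B := by
    intro w hw
    have h1 := I.mul_mem_right _ ((ofIdeal I).outerGap R w) hBI
    rw [smul_mul_assoc, barRep_mul_outerGap, if_pos hw] at h1
    exact w.2.2 ⟨w.2.1, hI.2 _ c hc h1⟩
  -- A point `w` of `B` would put `p_{r(e)}` into `I` for an edge `e` at `w` with `r(e) ∉ H`.
  have hl : ∀ w : ↥(G.breaking (ofIdeal I).H \ (ofIdeal I).S), Sum.inl w.1 ∉ B := by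
    intro w hw
    obtain ⟨e, he, her⟩ := w.2.1.2.1
    have h1 := I.mul_mem_left (G.tStar R e) _ (I.mul_mem_right _ (G.t R e) hBI)
    rw [smul_mul_assoc, (ofIdeal I).barRep_mul_t hB her, p_mul_t, if_pos (by rwa [he]),
      mul_smul_comm, tStar_mul_t] at h1
    exact her ⟨G.r_mem_sets e, hI.1 _ c hc h1⟩
  rw [(ofIdeal I).barRep_of_forall hB fun w => iff_of_false (hr w) (hl w)] at hBI
  refine (ofIdeal I).cls_eq_empty.2 ⟨Sum.inl ⁻¹' B, ⟨_, hI.1 _ c hc hBI⟩, fun x hx => ?_⟩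
  rcases x with v | w
  · exact ⟨v, hx, rfl⟩
  · exact absurd hx (hr w)

theorem idealOf_ofIdeal {I : TwoSidedIdeal (G.LeavittPathAlgebra R)} (hg : G.IsGraded I)
    (hI : G.IsBasic I) : G.idealOf R (ofIdeal I) = I := by
  refine le_antisymm (idealOf_ofIdeal_le I) fun x hx => ?_
  obtain ⟨f, hf, rfl⟩ := hg x hx
  refine sum_mem fun n _ => ?_
  obtain ⟨N, hN⟩ := (ofIdeal I).toQuotient_mem_degreePart (hf n).2
  rw [← toQuotient_eq_zero_iff]
  exact (ofIdeal I).quotientModel.eq_zero_of_mem_degreePart (smul_p_mem_mapIdeal hI) hN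
    ((ofIdeal I).mem_mapIdeal.2 ⟨_, (hf n).1, rfl⟩)

end AdmissiblePair

end Ultragraph

end

theorem theorem4p6 {V E : Type*} [Countable V] [Countable E] (G : Ultragraph V E)
    (R : Type*) [CommRing R] :
    (∀ P : G.AdmissiblePair,
      ∃ φ : P.quotient.LeavittAlgebra R ≃+* IdealQuotient (G.idealOf R P),
        ∀ (c : R) (x : P.quotient.LeavittAlgebra R), φ (c • x) = c • φ x) ∧
    (Nontrivial R →
      Set.BijOn (G.idealOf R) Set.univ {I | G.IsGraded I ∧ G.IsBasic I}) := by
  refine ⟨fun P => ⟨RingEquiv.ofBijective (P.ofQuotient R)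
    ⟨P.ofQuotient_injective, P.ofQuotient_surjective⟩, fun c x => map_smul (P.ofQuotient R) c x⟩,
    fun _ => ⟨fun P _ => ⟨P.isGraded_idealOf, P.isBasic_idealOf⟩, ?_, ?_⟩⟩
  · exact fun P _ P' _ h => Ultragraph.AdmissiblePair.idealOf_injective h
  · rintro I ⟨hg, hI⟩
    exact ⟨.ofIdeal I, Set.mem_univ _, Ultragraph.AdmissiblePair.idealOf_ofIdeal hg hI⟩
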